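/- For $l_x,l_y>0$ let $\Omega=\mathbb{T}^2_{xy}\times[0,1]$, where $\mathbb{T}^2_{xy}$ is the flat torus $[0,l_x]\times[0,l_y]$ (periodic in $x$ and $y$), and let $\langle f\rangle=\frac{1}{l_xl_y}\int_\Omega f$ denote the volume average. Let $\Delta^{-1}\colon H^{-1}(\Omega)\to H_0^1(\Omega)$ be the inverse Laplacian with vanishing Dirichlet conditions at the walls $z=0,1$. For $\varepsilon>0$ let $$\mathfrak{E}(\varepsilon)=\inf_{(\mathbf{u},\xi)}E_\varepsilon(\mathbf u,\xi),\qquad E_\varepsilon(\mathbf u,\xi)=\langle |\nabla\Delta^{-1}\mathrm{div}(\mathbf{u}\xi)|^2\rangle +\varepsilon\langle |\mathbf{u}|^2\rangle\,\langle |\nabla\xi|^2\rangle ,$$ where the infimum is over the admissible pairs: $\mathbf{u}=(u,v,w)\in L^2(\Omega;\mathbb{R}^3)$ is divergence-free with $w=0$ at the walls $z=0,1$ (in the sense of normal traces), $\xi\in H_0^1(\Omega)\cap L^\infty(\Omega)$, and $\langle w\xi\rangle =1$. There is an absolute constant $M>0$ such that for every $K>0$ there are constants $c,C>0$, depending only on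 $K$, such that the following holds for all $l_x,l_y>0$ and all $0<\varepsilon\le K\min(1,l_x^4,l_y^4)$. (1) $c\,\varepsilon^{1/2}\le\mathfrak{E}(\varepsilon)\le C\,\varepsilon^{1/2}$. (2) The upper bound is realized by convection rolls: there are $\delta\in(0,\tfrac12)$ and $l>0$ with $\frac1l\in\frac{2\pi}{l_x}\{1,2,3,\dots\}$, $\;c\,\varepsilon^{1/2}\le\delta\le C\varepsilon^{1/2}$, $\;c\,\delta^{1/2}\le l\le C\delta^{1/2}$, and a function $\chi\in C_c^\infty((0,1))$ with $\chi=1$ on $[\delta,1-\delta]$, $|\chi|\le M$, $|\chi'|\le M/\delta$ and $\int_0^1\chi^2=1$, such that with $\Psi(x)=\sqrt2\cos x$, $\psi(x,z)=\chi(z)\,l^{1/2}\Psi(x/l)$, $$\mathbf{u}=(-\partial_z\psi,0,\partial_x\psi),\qquad \xi(x,z)=\chi(z)\,l^{1/2}\Psi'(x/l),$$ the pair $(\mathbf u,\xi)$ is admissible and $E_\varepsilon(\mathbf u,\xi)\le C\varepsilon^{1/2}$. -/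

import Mathlib

open MeasureTheory Filter Topology Set
open scoped ContDiff

noncomputable section

namespace WallToWall

/-- Points `(x, y, z)` of `ℝ³`, with coordinates `p 0 = x`, `p 1 = y`, `p 2 = z`. -/
abbrev R3 : Type := EuclideanSpace ℝ (Fin 3)

/-- The period cell `[0, lx] × [0, ly] × [0, 1]` of the layer `Ω = 𝕋²_{xy} × [0, 1]`.
A function on `Ω` (up to null sets) is a function on this cell (up to null sets); the
periodicity in `x` and `y` enters through the test functions below. -/
def cell (lx ly : ℝ) : Set R3 :=
  {p | p 0 ∈ Icc 0 lx ∧ p 1 ∈ Icc 0 ly ∧ p 2 ∈ Icc 0 1}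

/-- Lebesgue measure on `Ω`. -/
def cellMeasure (lx ly : ℝ) : Measure R3 := volume.restrict (cell lx ly)

/-- Smooth functions on the closed layer: smooth functions of `(x, y, z) ∈ ℝ³` that are
`lx`-periodic in `x` and `ly`-periodic in `y` (only their values for `z ∈ [0, 1]` matter). -/
structure IsSmoothPeriodic (lx ly : ℝ) (φ : R3 → ℝ) : Prop where
  smooth : ContDiff ℝ ∞ φ
  periodic_x : ∀ p, φ (p + EuclideanSpace.single 0 lx) = φ p
  periodic_y : ∀ p, φ (p + EuclideanSpace.single 1 ly) = φ p

/-- The space `C_c^∞(Ω)`: smooth periodic functions vanishing near the walls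
`z = 0` and `z = 1`. -/
structure IsTestFunction (lx ly : ℝ) (φ : R3 → ℝ) : Prop
    extends IsSmoothPeriodic lx ly φ where
  vanishes_near_walls : ∃ a > 0, ∀ p : R3, p 2 ∉ Icc a (1 - a) → φ p = 0

/-- `f ∈ H¹₀(Ω)` and `∇f = g` in `L²(Ω; ℝ³)`: the pair `(f, g)` is an `L²`-limit of pairs
`(φₙ, ∇φₙ)` with `φₙ ∈ C_c^∞(Ω)`. -/
structure HasH10Gradient (lx ly : ℝ) (f : R3 → ℝ) (g : R3 → R3) : Prop where
  memLp : MemLp f 2 (cellMeasure lx ly)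
  grad_memLp : MemLp g 2 (cellMeasure lx ly)
  approx : ∃ φ : ℕ → R3 → ℝ, (∀ n, IsTestFunction lx ly (φ n)) ∧
    Tendsto (fun n => eLpNorm (fun p => φ n p - f p) 2 (cellMeasure lx ly)) atTop (𝓝 0) ∧
    Tendsto (fun n => eLpNorm (fun p => gradient (φ n) p - g p) 2 (cellMeasure lx ly))
      atTop (𝓝 0)

/-- `div u = 0` in the sense of distributions on `Ω`. -/
def IsDivFree (lx ly : ℝ) (u : R3 → R3) : Prop :=
  ∀ φ, IsTestFunction lx ly φ → ∫ p in cell lx ly, inner ℝ (u p) (gradient φ p) = 0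

/-- `w = 0` at the walls, for a divergence-free field `u = (·, ·, w) ∈ L²`, in the sense of
normal traces: by Green's formula `∫_Ω u · ∇φ` is the boundary pairing
`∫_{z = 1} w φ - ∫_{z = 0} w φ`, and it has to vanish for each smooth `φ` on the closed layer. -/
def HasZeroNormalTrace (lx ly : ℝ) (u : R3 → R3) : Prop :=
  ∀ φ, IsSmoothPeriodic lx ly φ → ∫ p in cell lx ly, inner ℝ (u p) (gradient φ p) = 0

/-- `ζ = Δ⁻¹ div m` with gradient `h = ∇ζ`: `ζ ∈ H¹₀(Ω)` is the weak solution (it exists and is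
unique for each `m ∈ L²`, by the Riesz representation theorem) of `Δζ = div m`. -/
structure IsInvLaplacianDiv (lx ly : ℝ) (m : R3 → R3) (ζ : R3 → ℝ) (h : R3 → R3) : Prop where
  mem_H10 : HasH10Gradient lx ly ζ h
  weak_eq : ∀ φ, IsTestFunction lx ly φ →
    ∫ p in cell lx ly, inner ℝ (h p) (gradient φ p)
      = ∫ p in cell lx ly, inner ℝ (m p) (gradient φ p)

/-- Admissible designs `(u, ξ)`: `u ∈ L²(Ω; ℝ³)` is divergence-free with `w = 0` at the walls,
`ξ ∈ H¹₀(Ω) ∩ L^∞(Ω)`, and the net flux `⨍_Ω w ξ` equals one. -/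
structure IsAdmissible (lx ly : ℝ) (u : R3 → R3) (ξ : R3 → ℝ) : Prop where
  u_memLp : MemLp u 2 (cellMeasure lx ly)
  u_divFree : IsDivFree lx ly u
  u_walls : HasZeroNormalTrace lx ly u
  ξ_bounded : MemLp ξ ⊤ (cellMeasure lx ly)
  ξ_mem_H10 : ∃ g, HasH10Gradient lx ly ξ g
  flux : ⨍ p in cell lx ly, u p 2 * ξ p = 1

/-- `E = ⨍_Ω |∇Δ⁻¹ div(u ξ)|² + ε ⨍_Ω |u|² ⨍_Ω |∇ξ|²`. -/
def HasEnergy (lx ly ε : ℝ) (u : R3 → R3) (ξ : R3 → ℝ) (E : ℝ) : Prop :=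
  ∃ (g : R3 → R3) (ζ : R3 → ℝ) (h : R3 → R3),
    HasH10Gradient lx ly ξ g ∧
    IsInvLaplacianDiv lx ly (fun p => ξ p • u p) ζ h ∧
    E = (⨍ p in cell lx ly, ‖h p‖ ^ 2)
      + ε * (⨍ p in cell lx ly, ‖u p‖ ^ 2) * (⨍ p in cell lx ly, ‖g p‖ ^ 2)

/-- The optimal value `𝔈(ε)` of the integral formulation of steady energy-constrained
wall-to-wall transport. -/
def optimalValue (lx ly ε : ℝ) : ℝ :=
  sInf {E | ∃ u ξ, IsAdmissible lx ly u ξ ∧ HasEnergy lx ly ε u ξ E}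

/-- The cut-off functions of boundary-layer thickness `δ` (with constant `M`) that enter the
convection rolls. -/
structure IsCutoff (M δ : ℝ) (χ : ℝ → ℝ) : Prop where
  smooth : ContDiff ℝ ∞ χ
  support : tsupport χ ⊆ Ioo 0 1
  eq_one : ∀ z ∈ Icc δ (1 - δ), χ z = 1
  bound : ∀ z, |χ z| ≤ M
  deriv_bound : ∀ z, |deriv χ z| ≤ M / δ
  normalized : ∫ z in (0 : ℝ)..1, χ z ^ 2 = 1

/-- The profile `Ψ(x) = √2 cos x`, for which `(Ψ')²` has mean one. -/
def rollProfile (x : ℝ) : ℝ := √2 * Real.cos x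

/-- The streamfunction `ψ(x, z) = χ(z) l^{1/2} Ψ(x / l)`. -/
def rollStream (χ : ℝ → ℝ) (l : ℝ) (p : R3) : ℝ := χ (p 2) * (√l * rollProfile (p 0 / l))

/-- The convection rolls `u = (-∂_z ψ, 0, ∂_x ψ)`. -/
def rollVelocity (χ : ℝ → ℝ) (l : ℝ) (p : R3) : R3 :=
  !₂[-(gradient (rollStream χ l) p 2), 0, gradient (rollStream χ l) p 0]

/-- The test function `ξ(x, z) = χ(z) l^{1/2} Ψ'(x / l)` that goes with the rolls. -/
def rollTest (χ : ℝ → ℝ) (l : ℝ) (p : R3) : ℝ := χ (p 2) * (√l * deriv rollProfile (p 0 / l))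

end WallToWall

end

namespace WallToWall

/-! Write `U`, `G`, `H` for the averages of `|u|²`, `|∇ξ|²` and `|∇Δ⁻¹ div(uξ)|²`.

Lower bound. The weak equation for `h = ∇Δ⁻¹ div(uξ)` is tested with `(z - 1/2) β(ξ)`, where `β(s) =
s² / (κ² + s²)`. Since `u` is divergence-free, an integration by parts turns the right-hand side
into `∫ w (ξ - κ arctan(ξ/κ))`. The first term is the flux, with average one; the second is at most
of order `κ √U`, so `κ = 1/(4√U)` leaves at least `1/2`. The truncation keeps the gradient of the
test function under control: its mean square is at most `2 + G/(2κ²) = 2(1 + 4UG)`. Young's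
inequality then gives the scale-invariant estimate `1 ≤ 8 (1 + 4UG) H`
(`one_le_mul_average_norm_sq`). Hence the energy is at least `1/(8(1 + 4X)) + εX` with `X = UG ≥ 0`,
which is bounded below by a multiple of `√ε` when `ε ≤ K` (`energy_lower_bound`).

Upper bound. For the rolls, `uξ` is `χ² e_z` plus the rotated gradient of a streamfunction, so
`div(uξ) = (χ²)'`. Because `χ²` has mean one, the nonlocal field is exactly `(χ² - 1) e_z`,
supported in the boundary layers (`IsCutoff.isInvLaplacianDiv_roll`). The averages `U` and `G` both
equal `l ∫ χ'² + 1/l`. The energy is therefore of order `δ + ε (l/δ + 1/l)²`; `l ~ √δ` balances the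
bracket and `δ ~ √ε` balances the sum. Periodicity quantizes `l`, which is harmless because
`ε^{1/4}` is at most a multiple of `lx` (`exists_optimal_rolls`). -/

/-! ### Gradients in coordinates and integrals over the period cell. -/

theorem gradient_apply (f : R3 → ℝ) (p : R3) (i : Fin 3) :
    gradient f p i = fderiv ℝ f p (EuclideanSpace.single i 1) := by
  have h := InnerProductSpace.toDual_symm_apply (𝕜 := ℝ) (x := EuclideanSpace.single i (1 : ℝ))
    (y := fderiv ℝ f p)
  rw [← h, gradient, real_inner_comm, EuclideanSpace.inner_single_left]
  simp

theorem gradient_eq_of_hasFDerivAt {f : R3 → ℝ} {p : R3} {L : R3 →L[ℝ] ℝ}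
    (h : HasFDerivAt f L p) (i : Fin 3) :
    gradient f p i = L (EuclideanSpace.single i 1) := by
  rw [gradient_apply, h.fderiv]

theorem inner_eq (a b : R3) : inner ℝ a b = a 0 * b 0 + a 1 * b 1 + a 2 * b 2 := by
  simp [PiLp.inner_apply, Fin.sum_univ_three, mul_comm]

theorem norm_sq_eq (a : R3) : ‖a‖ ^ 2 = a 0 ^ 2 + a 1 ^ 2 + a 2 ^ 2 := by
  rw [← real_inner_self_eq_norm_sq, inner_eq]; ring

theorem hasFDerivAt_coord (p : R3) (i : Fin 3) :
    HasFDerivAt (fun q : R3 => q i) (EuclideanSpace.proj (𝕜 := ℝ) i : R3 →L[ℝ] ℝ) p :=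
  (EuclideanSpace.proj (𝕜 := ℝ) i : R3 →L[ℝ] ℝ).hasFDerivAt

theorem contDiff_coord {n : WithTop ℕ∞} (i : Fin 3) : ContDiff ℝ n (fun q : R3 => q i) :=
  (EuclideanSpace.proj (𝕜 := ℝ) i : R3 →L[ℝ] ℝ).contDiff

/-- The gradient of a product of functions of `z` and of `x`. -/
theorem gradient_mul_coord {b a : ℝ → ℝ} {b' a' : ℝ} {p : R3}
    (hb : HasDerivAt b b' (p 2)) (ha : HasDerivAt a a' (p 0)) :
    gradient (fun q : R3 => b (q 2) * a (q 0)) p = !₂[b (p 2) * a', 0, b' * a (p 0)] := by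
  have h := (hb.comp_hasFDerivAt p (hasFDerivAt_coord p 2)).mul
    (ha.comp_hasFDerivAt p (hasFDerivAt_coord p 0))
  ext i
  erw [gradient_eq_of_hasFDerivAt h]
  fin_cases i <;> simp [mul_comm]

/-- The gradient of a function of `z`. -/
theorem gradient_coord {b : ℝ → ℝ} {b' : ℝ} {p : R3} (hb : HasDerivAt b b' (p 2)) :
    gradient (fun q : R3 => b (q 2)) p = !₂[0, 0, b'] := by
  have h := gradient_mul_coord hb (hasDerivAt_const (p 0) (1 : ℝ))
  simpa using h

theorem cell_eq_preimage (lx ly : ℝ) :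
    cell lx ly = WithLp.ofLp ⁻¹' (Icc (0 : Fin 3 → ℝ) ![lx, ly, 1]) := by
  ext p
  simp [cell, Set.mem_Icc, Pi.le_def, Fin.forall_fin_succ]
  tauto

theorem measurableSet_cell (lx ly : ℝ) : MeasurableSet (cell lx ly) := by
  rw [cell_eq_preimage]
  exact measurableSet_Icc.preimage (PiLp.volume_preserving_ofLp (Fin 3)).measurable

theorem isCompact_cell (lx ly : ℝ) : IsCompact (cell lx ly) := by
  rw [cell_eq_preimage]
  exact (EuclideanSpace.equiv (Fin 3) ℝ).toHomeomorph.isCompact_preimage.2 isCompact_Icc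

theorem integral_cell (lx ly : ℝ) (f : R3 → ℝ) :
    ∫ p in cell lx ly, f p
      = ∫ x in Icc (0 : Fin 3 → ℝ) ![lx, ly, 1], f (WithLp.toLp 2 x) := by
  rw [cell_eq_preimage]
  exact (PiLp.volume_preserving_ofLp (Fin 3)).setIntegral_preimage_emb
    (MeasurableEquiv.toLp 2 (Fin 3 → ℝ)).symm.measurableEmbedding
    (fun x => f (WithLp.toLp 2 x)) _

theorem integral_cell_prod {lx ly : ℝ} (hx : 0 ≤ lx) (hy : 0 ≤ ly) (f g : ℝ → ℝ) :
    ∫ p in cell lx ly, f (p 0) * g (p 2)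
      = (∫ x in (0 : ℝ)..lx, f x) * ly * ∫ z in (0 : ℝ)..1, g z := by
  rw [integral_cell, ← pi_univ_Icc, volume_pi, Measure.restrict_pi_pi]
  have h := integral_fintype_prod_eq_prod (𝕜 := ℝ)
    (μ := fun i : Fin 3 => (volume : Measure ℝ).restrict
      (Icc ((0 : Fin 3 → ℝ) i) ((![lx, ly, 1] : Fin 3 → ℝ) i)))
    (f := ![f, fun _ => 1, g])
  simp only [Fin.prod_univ_three] at h
  simp only [Matrix.cons_val_zero, Matrix.cons_val_one, Matrix.cons_val, mul_one] at h
  refine (h.trans ?_)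
  rw [intervalIntegral.integral_of_le hx, intervalIntegral.integral_of_le zero_le_one]
  simp [integral_Icc_eq_integral_Ioc, hy]

theorem volume_real_cell {lx ly : ℝ} (hx : 0 ≤ lx) (hy : 0 ≤ ly) :
    volume.real (cell lx ly) = lx * ly := by
  have h := integral_cell_prod hx hy (fun _ => 1) (fun _ => 1)
  simpa using h

theorem setAverage_cell {lx ly : ℝ} (hx : 0 ≤ lx) (hy : 0 ≤ ly) (f : R3 → ℝ) :
    ⨍ p in cell lx ly, f p = (lx * ly)⁻¹ * ∫ p in cell lx ly, f p := by
  rw [setAverage_eq, volume_real_cell hx hy, smul_eq_mul]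

instance isFiniteMeasure_cellMeasure (lx ly : ℝ) : IsFiniteMeasure (cellMeasure lx ly) :=
  ⟨by simpa [cellMeasure] using (isCompact_cell lx ly).measure_lt_top⟩

/-- The integral over the cell of a partial derivative vanishes when the function agrees on the
two opposite faces. -/
theorem integral_cell_partial_eq_zero {lx ly : ℝ} (hx : 0 ≤ lx) (hy : 0 ≤ ly) (i : Fin 3)
    {f : R3 → ℝ} (hf : ContDiff ℝ 1 f)
    (hper : ∀ p : R3, p i = 0 →
      f (p + EuclideanSpace.single i ((![lx, ly, 1] : Fin 3 → ℝ) i)) = f p) :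
    ∫ p in cell lx ly, fderiv ℝ f p (EuclideanSpace.single i 1) = 0 := by
  rw [integral_cell]
  set T : (Fin 3 → ℝ) →L[ℝ] R3 := (EuclideanSpace.equiv (Fin 3) ℝ).symm.toContinuousLinearMap
  have hT : ∀ x, T x = WithLp.toLp 2 x := fun x => rfl
  have hle : (0 : Fin 3 → ℝ) ≤ ![lx, ly, 1] := by
    intro j; fin_cases j <;> simp [hx, hy]
  have hd : Differentiable ℝ f := hf.differentiable one_ne_zero
  have hfT : ∀ x, HasFDerivAt (fun y => f (T y)) ((fderiv ℝ f (T x)).comp T) x := fun x =>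
    (hd (T x)).hasFDerivAt.comp x T.hasFDerivAt
  have hc : Continuous fun x => fderiv ℝ f (T x) (T (Pi.single i 1)) :=
    ((hf.continuous_fderiv one_ne_zero).comp T.continuous).clm_apply continuous_const
  -- Divergence theorem for the field whose only nonzero component is `f` in direction `i`: only the
  -- two faces orthogonal to `i` contribute, and they cancel.
  have key := integral_divergence_of_hasFDerivAt_off_countable' (E := ℝ) (n := 2)
    0 ![lx, ly, 1] hle
    (fun j => if j = i then fun y => f (T y) else fun _ => 0)
    (fun j => if j = i then fun x => (fderiv ℝ f (T x)).comp T else fun _ => 0)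
    ∅ countable_empty
    (fun j => by
      by_cases h : j = i
      · simp only [h, if_true]; exact (hf.continuous.comp T.continuous).continuousOn
      · simp only [h, if_false]; exact continuousOn_const)
    (fun x _ j => by
      by_cases h : j = i
      · simp only [h, if_true]; exact hfT x
      · simp only [h, if_false]; exact hasFDerivAt_const _ _)
    (by
      refine Continuous.integrableOn_Icc ?_
      refine continuous_finsetSum _ fun j _ => ?_
      by_cases h : j = i
      · subst h; simpa using hc
      · simpa [h] using continuous_const)
  have hs : ∀ x, ∑ j : Fin 3,
      (if j = i then fun x => (fderiv ℝ f (T x)).comp T else fun _ => 0 :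
        (Fin 3 → ℝ) → (Fin 3 → ℝ) →L[ℝ] ℝ) x (Pi.single j 1)
      = fderiv ℝ f (T x) (EuclideanSpace.single i 1) := by
    intro x
    rw [Finset.sum_eq_single i]
    · simp [hT]
    · intro j _ h; simp [h]
    · simp
  simp only [hs] at key
  refine key.trans (Finset.sum_eq_zero fun j _ => ?_)
  by_cases h : j = i
  · subst h
    simp only [if_true]
    rw [sub_eq_zero]
    congr 1
    funext y
    have := hper (T (j.insertNth 0 y)) (by simp [hT])
    rw [Pi.zero_apply, ← this]
    congr 1
    ext k
    rcases eq_or_ne k j with rfl | hk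
    · simp [hT]
    · obtain ⟨k', rfl⟩ := Fin.exists_succAbove_eq hk
      simp [hT]
  · simp [h]

/-! ### Convergence in `L²`. -/

section Lp

variable {α E : Type*} [MeasurableSpace α] {μ : Measure α} [NormedAddCommGroup E]

/-- Dominated convergence to zero in `L²`. -/
theorem tendsto_eLpNorm_two_zero_of_dominated {F : ℕ → α → E} {G : α → ℝ}
    (hF : ∀ n, AEStronglyMeasurable (F n) μ) (hG : MemLp G 2 μ)
    (hb : ∀ n, ∀ᵐ x ∂μ, ‖F n x‖ ≤ G x)
    (hlim : ∀ᵐ x ∂μ, Tendsto (fun n => F n x) atTop (𝓝 0)) :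
    Tendsto (fun n => eLpNorm (F n) 2 μ) atTop (𝓝 0) := by
  have h2 : (2 : ENNReal) ≠ 0 := two_ne_zero
  have ht : (2 : ENNReal) ≠ ⊤ := ENNReal.ofNat_ne_top
  have key : Tendsto (fun n => ∫⁻ x, ‖F n x‖ₑ ^ (2 : ℝ) ∂μ) atTop (𝓝 (∫⁻ _, 0 ∂μ)) := by
    refine tendsto_lintegral_of_dominated_convergence' (fun x => ‖G x‖ₑ ^ (2 : ℝ))
      (fun n => (hF n).enorm.pow_const _) (fun n => ?_) ?_ ?_
    · filter_upwards [hb n] with x hx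
      refine ENNReal.rpow_le_rpow ?_ zero_le_two
      rw [enorm_le_iff_norm_le]
      exact hx.trans (Real.le_norm_self _)
    · have := lintegral_rpow_enorm_lt_top_of_eLpNorm_lt_top h2 ht hG.2
      simpa using this.ne
    · filter_upwards [hlim] with x hx
      have h1 : Tendsto (fun n => ‖F n x‖ₑ) atTop (𝓝 0) := by simpa using hx.enorm
      have h3 := h1.ennrpow_const (2 : ℝ)
      simpa using h3
  have h3 := key.ennrpow_const (1 / 2 : ℝ)
  simp only [lintegral_zero] at h3
  rw [ENNReal.zero_rpow_of_pos (by norm_num)] at h3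
  refine h3.congr fun n => ?_
  rw [eLpNorm_eq_lintegral_rpow_enorm_toReal h2 ht]
  simp

theorem integrable_inner_of_memLp [InnerProductSpace ℝ E] {m b : α → E}
    (hm : MemLp m 2 μ) (hb : MemLp b 2 μ) : Integrable (fun x => inner ℝ (m x) (b x)) μ :=
  memLp_one_iff_integrable.1 (MemLp.of_bilin (fun x y => inner ℝ x y) 1 hm hb
    (hm.1.inner hb.1) (ae_of_all _ fun x => by
      rw [one_mul]; exact nnnorm_inner_le_nnnorm _ _))

theorem tendsto_integral_inner [InnerProductSpace ℝ E] {m a : α → E} {A : ℕ → α → E}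
    (hm : MemLp m 2 μ) (ha : MemLp a 2 μ) (hA : ∀ n, MemLp (A n) 2 μ)
    (hlim : Tendsto (fun n => eLpNorm (fun x => A n x - a x) 2 μ) atTop (𝓝 0)) :
    Tendsto (fun n => ∫ x, inner ℝ (m x) (A n x) ∂μ) atTop (𝓝 (∫ x, inner ℝ (m x) (a x) ∂μ)) := by
  refine tendsto_integral_of_L1' _ (integrable_inner_of_memLp hm ha).1
    (Eventually.of_forall fun n => integrable_inner_of_memLp hm (hA n)) ?_
  refine tendsto_of_tendsto_of_tendsto_of_le_of_le tendsto_const_nhds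
    (h := fun n => eLpNorm m 2 μ * eLpNorm (fun x => A n x - a x) 2 μ) ?_ (fun _ => zero_le)
    (fun n => ?_)
  · have := ENNReal.Tendsto.const_mul hlim (Or.inr hm.2.ne)
    simpa using this
  · have h := eLpNorm_le_eLpNorm_mul_eLpNorm'_of_norm (p := 2) (q := 2) (r := 1) hm.1
      ((hA n).1.sub ha.1) (fun x y => inner ℝ x y) 1 (ae_of_all _ fun x => by
        rw [NNReal.coe_one, one_mul]; exact norm_inner_le_norm _ _)
    rw [ENNReal.coe_one, one_mul] at h
    refine le_trans (le_of_eq ?_) h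
    congr 1
    funext x
    simp [inner_sub_right]

end Lp

/-! ### The chain rule for `(z - 1/2) β(f)` with `f` in `H¹₀`. -/

variable {lx ly : ℝ}

theorem continuous_gradient {f : R3 → ℝ} (hf : ContDiff ℝ ∞ f) : Continuous (gradient f) := by
  have h : Continuous (fderiv ℝ f) := hf.continuous_fderiv (by simp)
  exact (InnerProductSpace.toDual ℝ R3).symm.continuous.comp h

theorem ae_mem_cell : ∀ᵐ p ∂(cellMeasure lx ly), p ∈ cell lx ly :=
  ae_restrict_mem (measurableSet_cell lx ly)

theorem memLp_cell_of_continuous {E : Type*} [NormedAddCommGroup E]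
    {f : R3 → E} (hf : Continuous f) (q : ENNReal) :
    MemLp f q (cellMeasure lx ly) := by
  obtain ⟨C, hC⟩ := (isCompact_cell lx ly).exists_bound_of_continuousOn hf.continuousOn
  refine MemLp.of_bound hf.aestronglyMeasurable C ?_
  filter_upwards [ae_mem_cell] with p hp using hC p hp

/-- The field `β(f) e_z + (z - 1/2) β'(f) g`, which is the gradient of `(z - 1/2) β(f)` when `g` is
the gradient of `f`. -/
noncomputable def tiltGradient (β : ℝ → ℝ) (f : R3 → ℝ) (g : R3 → R3) (p : R3) : R3 :=
  β (f p) • EuclideanSpace.single 2 (1 : ℝ) + ((p 2 - 1 / 2) * deriv β (f p)) • g p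

/-- The condition `β 0 = 0` preserves the vanishing near the walls, and a smooth `β` keeps the
composition among test functions. The factor `z - 1/2` has `z`-derivative one, which is what
extracts the vertical flux; its centring makes it at most `1/2` in absolute value on the cell. -/
theorem IsTestFunction.tilt {β : ℝ → ℝ} (hβ : ContDiff ℝ ∞ β) (h0 : β 0 = 0) {φ : R3 → ℝ}
    (hφ : IsTestFunction lx ly φ) :
    IsTestFunction lx ly (fun p => (p 2 - 1 / 2) * β (φ p)) where
  smooth := ((contDiff_coord 2).sub contDiff_const).mul (hβ.comp hφ.smooth)
  periodic_x p := by simp [hφ.periodic_x]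
  periodic_y p := by simp [hφ.periodic_y]
  vanishes_near_walls := by
    obtain ⟨a, ha, h⟩ := hφ.vanishes_near_walls
    exact ⟨a, ha, fun p hp => by simp [h p hp, h0]⟩

theorem gradient_tilt {β : ℝ → ℝ} (hβ : ContDiff ℝ ∞ β) {φ : R3 → ℝ} (hφ : ContDiff ℝ ∞ φ) (p : R3) :
    gradient (fun p : R3 => (p 2 - 1 / 2) * β (φ p)) p = tiltGradient β φ (gradient φ) p := by
  have h1 : HasFDerivAt φ (fderiv ℝ φ p) p := (hφ.differentiable (by simp) p).hasFDerivAt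
  have h2 : HasDerivAt β (deriv β (φ p)) (φ p) := (hβ.differentiable (by simp) _).hasDerivAt
  have h := ((hasFDerivAt_coord p 2).sub_const (1 / 2)).mul (h2.comp_hasFDerivAt p h1)
  ext i
  erw [gradient_eq_of_hasFDerivAt h]
  simp only [tiltGradient, PiLp.add_apply, PiLp.smul_apply, gradient_apply, smul_eq_mul]
  fin_cases i <;> simp [mul_assoc]
  ring

theorem continuous_deriv_of_smooth {β : ℝ → ℝ} (hβ : ContDiff ℝ ∞ β) : Continuous (deriv β) :=
  hβ.continuous_deriv (by simp)

theorem abs_sub_le_of_deriv_le {β : ℝ → ℝ} (hβ : ContDiff ℝ ∞ β) {L : ℝ}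
    (hL : ∀ s, |deriv β s| ≤ L) (s t : ℝ) : |β s - β t| ≤ L * |s - t| := by
  have := Convex.norm_image_sub_le_of_norm_deriv_le (f := β) (s := univ) (x := t) (y := s) (C := L)
    (fun x _ => hβ.differentiable (by simp) x) (fun x _ => hL x) convex_univ trivial trivial
  simpa using this

theorem aestronglyMeasurable_tiltGradient {β : ℝ → ℝ} (hβ : ContDiff ℝ ∞ β) {f : R3 → ℝ}
    {g : R3 → R3} (hf : AEStronglyMeasurable f (cellMeasure lx ly))
    (hg : AEStronglyMeasurable g (cellMeasure lx ly)) :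
    AEStronglyMeasurable (tiltGradient β f g) (cellMeasure lx ly) := by
  have h1 := hβ.continuous.comp_aestronglyMeasurable hf
  have h2 := (continuous_deriv_of_smooth hβ).comp_aestronglyMeasurable hf
  have h3 : AEStronglyMeasurable (fun p : R3 => p 2 - 1 / 2) (cellMeasure lx ly) :=
    (((contDiff_coord (n := 0) 2).continuous).sub continuous_const).aestronglyMeasurable
  exact (h1.smul aestronglyMeasurable_const).add ((h3.mul h2).smul hg)

theorem abs_sub_half_le {p : R3} (hp : p ∈ cell lx ly) : |p 2 - 1 / 2| ≤ 1 / 2 := by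
  have := hp.2.2
  rw [abs_le]; constructor <;> linarith [this.1, this.2]

theorem memLp_tiltGradient {β : ℝ → ℝ} (hβ : ContDiff ℝ ∞ β) (h0 : β 0 = 0) {L : ℝ}
    (hL : ∀ s, |deriv β s| ≤ L) {f : R3 → ℝ} {g : R3 → R3} (hf : MemLp f 2 (cellMeasure lx ly))
    (hg : MemLp g 2 (cellMeasure lx ly)) :
    MemLp (tiltGradient β f g) 2 (cellMeasure lx ly) := by
  have hL0 : 0 ≤ L := (abs_nonneg _).trans (hL 0)
  have hb : MemLp (fun p => L * ‖f p‖ + L * ‖g p‖) 2 (cellMeasure lx ly) :=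
    (hf.norm.const_mul L).add (hg.norm.const_mul L)
  refine hb.of_le (aestronglyMeasurable_tiltGradient hβ hf.1 hg.1) ?_
  filter_upwards [ae_mem_cell] with p hp
  have h1 : |β (f p)| ≤ L * |f p| := by simpa [h0] using abs_sub_le_of_deriv_le hβ hL (f p) 0
  have h2 : |(p 2 - 1 / 2) * deriv β (f p)| ≤ L := by
    rw [abs_mul]
    nlinarith [abs_sub_half_le hp, hL (f p), abs_nonneg (p 2 - 1 / 2), abs_nonneg (deriv β (f p))]
  refine le_trans ?_ (Real.le_norm_self _)
  refine (norm_add_le _ _).trans (add_le_add ?_ ?_)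
  · simpa [norm_smul] using h1
  · rw [norm_smul]; exact mul_le_mul_of_nonneg_right h2 (norm_nonneg _)

/-- `H¹₀` functions are approximated almost everywhere along a subsequence. -/
theorem HasH10Gradient.exists_approx_ae {f : R3 → ℝ} {g : R3 → R3}
    (h : HasH10Gradient lx ly f g) :
    ∃ φ : ℕ → R3 → ℝ, (∀ n, IsTestFunction lx ly (φ n)) ∧
      Tendsto (fun n => eLpNorm (fun p => φ n p - f p) 2 (cellMeasure lx ly)) atTop (𝓝 0) ∧
      Tendsto (fun n => eLpNorm (fun p => gradient (φ n) p - g p) 2 (cellMeasure lx ly))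
        atTop (𝓝 0) ∧
      ∀ᵐ p ∂(cellMeasure lx ly), Tendsto (fun n => φ n p) atTop (𝓝 (f p)) := by
  obtain ⟨φ, hφ, h1, h2⟩ := h.approx
  have hm : TendstoInMeasure (cellMeasure lx ly) φ atTop f :=
    tendstoInMeasure_of_tendsto_eLpNorm two_ne_zero
      (fun n => (hφ n).smooth.continuous.aestronglyMeasurable) h.memLp.1 h1
  obtain ⟨ns, hns, hae⟩ := hm.exists_seq_tendsto_ae
  exact ⟨fun n => φ (ns n), fun n => hφ _, h1.comp hns.tendsto_atTop, h2.comp hns.tendsto_atTop, hae⟩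

/-- The chain rule for `(z - 1/2) β(f)` with `f ∈ H¹₀`: the tilted gradient is an `L²`-limit of
gradients of test functions. -/
theorem HasH10Gradient.tilt {β : ℝ → ℝ} (hβ : ContDiff ℝ ∞ β) (h0 : β 0 = 0) {L : ℝ}
    (hL : ∀ s, |deriv β s| ≤ L) {f : R3 → ℝ} {g : R3 → R3} (h : HasH10Gradient lx ly f g) :
    ∃ θ : ℕ → R3 → ℝ, (∀ n, IsTestFunction lx ly (θ n)) ∧
      Tendsto (fun n => eLpNorm (fun p => gradient (θ n) p - tiltGradient β f g p) 2
        (cellMeasure lx ly)) atTop (𝓝 0) := by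
  obtain ⟨φ, hφ, h1, h2, hae⟩ := h.exists_approx_ae
  refine ⟨fun n p => (p 2 - 1 / 2) * β (φ n p), fun n => (hφ n).tilt hβ h0, ?_⟩
  have hL0 : 0 ≤ L := (abs_nonneg _).trans (hL 0)
  set μ := cellMeasure lx ly
  have hφm : ∀ n, AEStronglyMeasurable (φ n) μ := fun n =>
    (hφ n).smooth.continuous.aestronglyMeasurable
  have hgm : ∀ n, AEStronglyMeasurable (gradient (φ n)) μ := fun n =>
    (continuous_gradient (hφ n).smooth).aestronglyMeasurable
  have hz : AEStronglyMeasurable (fun p : R3 => p 2 - 1 / 2) μ :=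
    (((contDiff_coord (n := 0) 2).continuous).sub continuous_const).aestronglyMeasurable
  have hβm := continuous_deriv_of_smooth hβ
  -- `S1` and `S2` are controlled by the `L²` convergence of `φ n` and of its gradient. In `R` the
  -- field `g` is fixed and only `β'(φ n)` varies, so almost everywhere convergence and domination
  -- by a multiple of `|g|` suffice; no bound on `β''` is needed.
  let R : ℕ → R3 → R3 := fun n p => ((p 2 - 1 / 2) * (deriv β (φ n p) - deriv β (f p))) • g p
  let S1 : ℕ → R3 → R3 := fun n p => (β (φ n p) - β (f p)) • EuclideanSpace.single 2 (1 : ℝ)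
  let S2 : ℕ → R3 → R3 := fun n p =>
    ((p 2 - 1 / 2) * deriv β (φ n p)) • (gradient (φ n) p - g p)
  have hRm : ∀ n, AEStronglyMeasurable (R n) μ := fun n =>
    (hz.mul ((hβm.comp_aestronglyMeasurable (hφm n)).sub
      (hβm.comp_aestronglyMeasurable h.memLp.1))).smul h.grad_memLp.1
  have hS1m : ∀ n, AEStronglyMeasurable (S1 n) μ := fun n =>
    ((hβ.continuous.comp_aestronglyMeasurable (hφm n)).sub
      (hβ.continuous.comp_aestronglyMeasurable h.memLp.1)).smul aestronglyMeasurable_const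
  have hS2m : ∀ n, AEStronglyMeasurable (S2 n) μ := fun n =>
    (hz.mul (hβm.comp_aestronglyMeasurable (hφm n))).smul ((hgm n).sub h.grad_memLp.1)
  have hR : Tendsto (fun n => eLpNorm (R n) 2 μ) atTop (𝓝 0) := by
    refine tendsto_eLpNorm_two_zero_of_dominated hRm (h.grad_memLp.norm.const_mul L) ?_ ?_
    · intro n
      filter_upwards [ae_mem_cell] with p hp
      rw [norm_smul, norm_mul]
      refine mul_le_mul_of_nonneg_right ?_ (norm_nonneg _)
      have h3 := abs_sub (deriv β (φ n p)) (deriv β (f p))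
      have h4 := hL (φ n p)
      have h5 := hL (f p)
      have h6 := abs_sub_half_le hp
      simp only [Real.norm_eq_abs]
      nlinarith [abs_nonneg (p 2 - 1 / 2), abs_nonneg (deriv β (φ n p) - deriv β (f p))]
    · filter_upwards [hae] with p hp
      have h3 : Tendsto (fun n => deriv β (φ n p)) atTop (𝓝 (deriv β (f p))) :=
        (hβm.tendsto _).comp hp
      have h4 := ((h3.sub_const (deriv β (f p))).const_mul (p 2 - 1 / 2)).smul_const (g p)
      simpa [R] using h4
  have hS1 : Tendsto (fun n => eLpNorm (S1 n) 2 μ) atTop (𝓝 0) := by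
    refine tendsto_of_tendsto_of_tendsto_of_le_of_le tendsto_const_nhds
      (h := fun n => ENNReal.ofReal L * eLpNorm (fun p => φ n p - f p) 2 μ) ?_
      (fun _ => zero_le) (fun n => ?_)
    · simpa using ENNReal.Tendsto.const_mul h1 (Or.inr ENNReal.ofReal_ne_top)
    · refine eLpNorm_le_mul_eLpNorm_of_ae_le_mul (ae_of_all _ fun p => ?_) 2
      simpa [S1, norm_smul] using abs_sub_le_of_deriv_le hβ hL (φ n p) (f p)
  have hS2 : Tendsto (fun n => eLpNorm (S2 n) 2 μ) atTop (𝓝 0) := by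
    refine tendsto_of_tendsto_of_tendsto_of_le_of_le tendsto_const_nhds
      (h := fun n => ENNReal.ofReal L * eLpNorm (fun p => gradient (φ n) p - g p) 2 μ) ?_
      (fun _ => zero_le) (fun n => ?_)
    · simpa using ENNReal.Tendsto.const_mul h2 (Or.inr ENNReal.ofReal_ne_top)
    · refine eLpNorm_le_mul_eLpNorm_of_ae_le_mul ?_ 2
      filter_upwards [ae_mem_cell] with p hp
      rw [norm_smul, norm_mul]
      refine mul_le_mul_of_nonneg_right ?_ (norm_nonneg _)
      have h4 := hL (φ n p)
      have h6 := abs_sub_half_le hp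
      simp only [Real.norm_eq_abs]
      nlinarith [abs_nonneg (p 2 - 1 / 2), abs_nonneg (deriv β (φ n p))]
  refine tendsto_of_tendsto_of_tendsto_of_le_of_le tendsto_const_nhds
    (h := fun n => eLpNorm (S1 n) 2 μ + eLpNorm (S2 n) 2 μ + eLpNorm (R n) 2 μ) ?_
    (fun _ => zero_le) (fun n => ?_)
  · simpa using (hS1.add hS2).add hR
  · have e : (fun p => gradient (fun p : R3 => (p 2 - 1 / 2) * β (φ n p)) p - tiltGradient β f g p)
        = S1 n + S2 n + R n := by
      funext p
      rw [gradient_tilt hβ (hφ n).smooth]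
      simp only [tiltGradient, S1, S2, R, Pi.add_apply]
      module
    rw [e]
    refine (eLpNorm_add_le ((hS1m n).add (hS2m n)) (hRm n) one_le_two).trans ?_
    exact add_le_add_left (eLpNorm_add_le (hS1m n) (hS2m n) one_le_two) _

/-- A weak identity against the gradients of test functions passes to the tilted compositions. -/
theorem HasH10Gradient.integral_inner_tilt_eq {β : ℝ → ℝ} (hβ : ContDiff ℝ ∞ β) (h0 : β 0 = 0)
    {L : ℝ} (hL : ∀ s, |deriv β s| ≤ L) {f : R3 → ℝ} {g : R3 → R3}
    (h : HasH10Gradient lx ly f g) {m m' : R3 → R3} (hm : MemLp m 2 (cellMeasure lx ly))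
    (hm' : MemLp m' 2 (cellMeasure lx ly))
    (heq : ∀ φ, IsTestFunction lx ly φ → ∫ p in cell lx ly, inner ℝ (m p) (gradient φ p)
      = ∫ p in cell lx ly, inner ℝ (m' p) (gradient φ p)) :
    ∫ p in cell lx ly, inner ℝ (m p) (tiltGradient β f g p)
      = ∫ p in cell lx ly, inner ℝ (m' p) (tiltGradient β f g p) := by
  obtain ⟨θ, hθ, hlim⟩ := h.tilt hβ h0 hL
  have hG := memLp_tiltGradient hβ h0 hL h.memLp h.grad_memLp
  have hθm : ∀ n, MemLp (gradient (θ n)) 2 (cellMeasure lx ly) := fun n =>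
    memLp_cell_of_continuous (continuous_gradient (hθ n).smooth) 2
  refine tendsto_nhds_unique (tendsto_integral_inner hm hG hθm hlim) ?_
  refine (tendsto_integral_inner hm' hG hθm hlim).congr fun n => ?_
  exact (heq _ (hθ n)).symm

/-! ### The truncation and its bounds. -/

/-- The smooth truncation `s² / (κ² + s²)`. -/
noncomputable def trunc (κ s : ℝ) : ℝ := s ^ 2 / (κ ^ 2 + s ^ 2)

/-- The primitive of `s * trunc' κ s` that vanishes at `0`. -/
noncomputable def truncPrimitive (κ s : ℝ) : ℝ :=
  κ * Real.arctan (s / κ) - s * κ ^ 2 / (κ ^ 2 + s ^ 2)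

theorem contDiff_trunc {κ : ℝ} (hκ : 0 < κ) : ContDiff ℝ ∞ (trunc κ) := by
  unfold trunc
  exact (contDiff_id.pow 2).div (contDiff_const.add (contDiff_id.pow 2))
    fun s => by positivity

theorem contDiff_truncPrimitive {κ : ℝ} (hκ : 0 < κ) : ContDiff ℝ ∞ (truncPrimitive κ) := by
  unfold truncPrimitive
  exact (contDiff_const.mul (contDiff_id.div_const κ).arctan).sub
    ((contDiff_id.mul contDiff_const).div (contDiff_const.add (contDiff_id.pow 2))
      fun s => by positivity)

theorem deriv_trunc {κ : ℝ} (hκ : 0 < κ) (s : ℝ) :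
    deriv (trunc κ) s = 2 * s * κ ^ 2 / (κ ^ 2 + s ^ 2) ^ 2 := by
  have hne : κ ^ 2 + s ^ 2 ≠ 0 := by positivity
  have h1 : HasDerivAt (fun s : ℝ => s ^ 2) (2 * s) s := by simpa using hasDerivAt_pow 2 s
  have h : HasDerivAt (trunc κ) _ s := h1.div (h1.const_add (κ ^ 2)) hne
  rw [h.deriv]
  ring

/-- With `B = truncPrimitive κ`, this makes `ξ β'(ξ) u·∇ξ = u·∇B(ξ)`, to which the divergence-free
condition on `u` applies. -/
theorem deriv_truncPrimitive {κ : ℝ} (hκ : 0 < κ) (s : ℝ) :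
    deriv (truncPrimitive κ) s = s * deriv (trunc κ) s := by
  have hne : κ ^ 2 + s ^ 2 ≠ 0 := by positivity
  have h1 : HasDerivAt (fun s : ℝ => s ^ 2) (2 * s) s := by simpa using hasDerivAt_pow 2 s
  have h2 : HasDerivAt (fun s : ℝ => κ * Real.arctan (s / κ))
      (κ * (1 / (1 + (s / κ) ^ 2) * (1 / κ))) s :=
    (((hasDerivAt_id s).div_const κ).arctan).const_mul κ
  have h3 : HasDerivAt (fun s : ℝ => s * κ ^ 2) (1 * κ ^ 2) s := (hasDerivAt_id s).mul_const _
  have h : HasDerivAt (truncPrimitive κ) _ s := h2.sub (h3.div (h1.const_add (κ ^ 2)) hne)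
  rw [h.deriv, deriv_trunc hκ]
  field_simp
  ring

theorem trunc_zero (κ : ℝ) : trunc κ 0 = 0 := by simp [trunc]

theorem truncPrimitive_zero (κ : ℝ) : truncPrimitive κ 0 = 0 := by simp [truncPrimitive]

theorem abs_trunc_le_one {κ : ℝ} (hκ : 0 < κ) (s : ℝ) : |trunc κ s| ≤ 1 := by
  have : 0 < κ ^ 2 + s ^ 2 := by positivity
  rw [trunc, abs_div, abs_of_pos this, abs_of_nonneg (sq_nonneg s), div_le_one this]
  nlinarith

theorem abs_deriv_trunc_le {κ : ℝ} (hκ : 0 < κ) (s : ℝ) : |deriv (trunc κ) s| ≤ 1 / κ := by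
  have : 0 < κ ^ 2 + s ^ 2 := by positivity
  rw [deriv_trunc hκ, abs_div, abs_of_pos (pow_pos this 2), div_le_div_iff₀ (pow_pos this 2) hκ,
    abs_mul, abs_mul, abs_of_pos (pow_pos hκ 2), ← sq_abs s]
  rw [← sq_abs s] at this
  have h2 : |(2 : ℝ)| = 2 := by norm_num
  rw [h2]
  nlinarith [mul_nonneg (sq_nonneg (κ - |s|)) (sq_nonneg κ), sq_nonneg (κ - |s|),
    mul_nonneg (sq_nonneg κ) (sq_nonneg |s|), pow_nonneg (abs_nonneg s) 4]

theorem abs_deriv_truncPrimitive_le {κ : ℝ} (hκ : 0 < κ) (s : ℝ) :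
    |deriv (truncPrimitive κ) s| ≤ 1 := by
  have : 0 < κ ^ 2 + s ^ 2 := by positivity
  have e : s * (2 * s * κ ^ 2 / (κ ^ 2 + s ^ 2) ^ 2)
      = 2 * (s ^ 2 * κ ^ 2) / (κ ^ 2 + s ^ 2) ^ 2 := by ring
  rw [deriv_truncPrimitive hκ, deriv_trunc hκ, e, abs_of_nonneg (by positivity),
    div_le_one (by positivity)]
  nlinarith [sq_nonneg (s ^ 2), sq_nonneg (κ ^ 2)]

/-- Integration by parts in `s`: both sides are the primitive of `trunc κ` vanishing at zero. It
differs from `s` by a bounded function, so the tested transport term is the flux up to an error of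
order `κ`. -/
theorem mul_trunc_sub_truncPrimitive {κ : ℝ} (hκ : 0 < κ) (s : ℝ) :
    s * trunc κ s - truncPrimitive κ s = s - κ * Real.arctan (s / κ) := by
  have hne : κ ^ 2 + s ^ 2 ≠ 0 := by positivity
  rw [trunc, truncPrimitive]
  field_simp
  ring

theorem abs_mul_arctan_le {κ : ℝ} (hκ : 0 < κ) (s : ℝ) : |κ * Real.arctan (s / κ)| ≤ 2 * κ := by
  have h1 := Real.arctan_lt_pi_div_two (s / κ)
  have h2 := Real.neg_pi_div_two_lt_arctan (s / κ)
  have h3 := Real.pi_lt_four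
  rw [abs_mul, abs_of_pos hκ, mul_comm]
  refine mul_le_mul_of_nonneg_right (abs_le.2 ⟨?_, ?_⟩) hκ.le <;> linarith

/-! ### The lower bound on the energy. -/

theorem memLp_coord {u : R3 → R3} (hu : MemLp u 2 (cellMeasure lx ly)) (i : Fin 3) :
    MemLp (fun p => u p i) 2 (cellMeasure lx ly) :=
  (EuclideanSpace.proj (𝕜 := ℝ) i : R3 →L[ℝ] ℝ).comp_memLp' hu

theorem memLp_smul_of_bounded {u : R3 → R3} {ξ : R3 → ℝ} (hu : MemLp u 2 (cellMeasure lx ly))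
    (hξ : MemLp ξ ⊤ (cellMeasure lx ly)) : MemLp (fun p => ξ p • u p) 2 (cellMeasure lx ly) :=
  MemLp.smul (p := ⊤) (q := 2) (r := 2) hu hξ

theorem inner_tiltGradient (m : R3) (β : ℝ → ℝ) (f : R3 → ℝ) (g : R3 → R3) (p : R3) :
    inner ℝ m (tiltGradient β f g p)
      = β (f p) * m 2 + (p 2 - 1 / 2) * deriv β (f p) * inner ℝ m (g p) := by
  rw [tiltGradient, inner_add_right, inner_smul_right, inner_smul_right,
    EuclideanSpace.inner_single_right]
  simp

/-- The transport term seen by the truncated test function. -/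
theorem integral_inner_tiltGradient_eq {κ : ℝ} (hκ : 0 < κ) {u : R3 → R3} {ξ : R3 → ℝ}
    {g : R3 → R3} {ζ : R3 → ℝ} {h : R3 → R3} (hu : MemLp u 2 (cellMeasure lx ly))
    (hdiv : IsDivFree lx ly u) (hb : MemLp ξ ⊤ (cellMeasure lx ly))
    (hg : HasH10Gradient lx ly ξ g)
    (hζ : IsInvLaplacianDiv lx ly (fun p => ξ p • u p) ζ h) :
    ∫ p in cell lx ly, inner ℝ (h p) (tiltGradient (trunc κ) ξ g p)
      = ∫ p in cell lx ly, u p 2 * (ξ p - κ * Real.arctan (ξ p / κ)) := by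
  have hm := memLp_smul_of_bounded hu hb
  have h1 := hg.integral_inner_tilt_eq (contDiff_trunc hκ) (trunc_zero κ) (abs_deriv_trunc_le hκ)
    hζ.mem_H10.grad_memLp hm hζ.weak_eq
  -- The divergence-free condition, tested with `(z - 1/2) B(ξ)`: it trades `(z - 1/2) u·∇B(ξ)` for
  -- `-w B(ξ)` under the integral.
  have h2 := hg.integral_inner_tilt_eq (contDiff_truncPrimitive hκ) (truncPrimitive_zero κ)
    (abs_deriv_truncPrimitive_le hκ) hu (MemLp.zero' (μ := cellMeasure lx ly)) (fun φ hφ => by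
      simpa using hdiv φ hφ)
  simp only [inner_zero_left, integral_zero] at h2
  have i1 := integrable_inner_of_memLp hm (memLp_tiltGradient (contDiff_trunc hκ) (trunc_zero κ)
    (abs_deriv_trunc_le hκ) hg.memLp hg.grad_memLp)
  have i2 := integrable_inner_of_memLp hu (memLp_tiltGradient (contDiff_truncPrimitive hκ)
    (truncPrimitive_zero κ) (abs_deriv_truncPrimitive_le hκ) hg.memLp hg.grad_memLp)
  rw [h1, ← sub_zero (∫ p in cell lx ly, inner ℝ (ξ p • u p) _), ← h2]
  refine (integral_sub i1 i2).symm.trans (integral_congr_ae (ae_of_all _ fun p => ?_))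
  simp only [inner_tiltGradient, ← mul_trunc_sub_truncPrimitive hκ, deriv_truncPrimitive hκ,
    real_inner_smul_left]
  ring

/-- The two summands are at most `1` and `|g| / (2κ)`, since `|β| ≤ 1`, `|z - 1/2| ≤ 1/2` and `|β'|
≤ 1/κ`; then `(1 + t)² ≤ 2 + 2t²`. -/
theorem norm_sq_tiltGradient_le {κ : ℝ} (hκ : 0 < κ) {f : R3 → ℝ} {g : R3 → R3} {p : R3}
    (hp : p ∈ cell lx ly) :
    ‖tiltGradient (trunc κ) f g p‖ ^ 2 ≤ 2 + 1 / (2 * κ ^ 2) * ‖g p‖ ^ 2 := by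
  have h1 : ‖trunc κ (f p) • EuclideanSpace.single (2 : Fin 3) (1 : ℝ)‖ ≤ 1 := by
    simpa [norm_smul] using abs_trunc_le_one hκ (f p)
  have h2 : ‖((p 2 - 1 / 2) * deriv (trunc κ) (f p)) • g p‖ ≤ 1 / (2 * κ) * ‖g p‖ := by
    rw [norm_smul, norm_mul]
    refine mul_le_mul_of_nonneg_right ?_ (norm_nonneg _)
    have h3 := mul_le_mul (abs_sub_half_le hp) (abs_deriv_trunc_le hκ (f p)) (abs_nonneg _)
      (by norm_num)
    refine h3.trans (le_of_eq ?_)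
    field_simp
  have h3 := (norm_add_le (trunc κ (f p) • EuclideanSpace.single (2 : Fin 3) (1 : ℝ))
    (((p 2 - 1 / 2) * deriv (trunc κ) (f p)) • g p)).trans (add_le_add h1 h2)
  have h4 : ‖tiltGradient (trunc κ) f g p‖ ^ 2 ≤ (1 + 1 / (2 * κ) * ‖g p‖) ^ 2 :=
    pow_le_pow_left₀ (norm_nonneg _) h3 2
  have h5 : 1 / (2 * κ ^ 2) * ‖g p‖ ^ 2 = 2 * (1 / (2 * κ) * ‖g p‖) ^ 2 := by
    field_simp
  rw [h5]
  nlinarith [sq_nonneg (1 - 1 / (2 * κ) * ‖g p‖)]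

/-- The scale-invariant lower bound on the nonlocal term. -/
theorem one_le_mul_average_norm_sq (hx : 0 < lx) (hy : 0 < ly) {u : R3 → R3} {ξ : R3 → ℝ}
    {g : R3 → R3} {ζ : R3 → ℝ} {h : R3 → R3} (hadm : IsAdmissible lx ly u ξ)
    (hg : HasH10Gradient lx ly ξ g)
    (hζ : IsInvLaplacianDiv lx ly (fun p => ξ p • u p) ζ h) :
    1 ≤ 8 * (1 + 4 * ((⨍ p in cell lx ly, ‖u p‖ ^ 2) * ⨍ p in cell lx ly, ‖g p‖ ^ 2)) *
      ⨍ p in cell lx ly, ‖h p‖ ^ 2 := by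
  have hu := hadm.u_memLp
  have hflux := hadm.flux
  have hw := memLp_coord hu 2
  have iu : IntegrableOn (fun p => ‖u p‖ ^ 2) (cell lx ly) := hu.integrable_norm_pow two_ne_zero
  have ih : IntegrableOn (fun p => ‖h p‖ ^ 2) (cell lx ly) :=
    hζ.mem_H10.grad_memLp.integrable_norm_pow two_ne_zero
  have ig : IntegrableOn (fun p => ‖g p‖ ^ 2) (cell lx ly) :=
    hg.grad_memLp.integrable_norm_pow two_ne_zero
  have iwξ : IntegrableOn (fun p => u p 2 * ξ p) (cell lx ly) := hw.integrable_mul hg.memLp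
  rw [setAverage_cell hx.le hy.le] at hflux ⊢
  rw [setAverage_cell hx.le hy.le, setAverage_cell hx.le hy.le]
  set a := (lx * ly)⁻¹ with ha
  have ha0 : 0 < a := by positivity
  have hone : a * ∫ p in cell lx ly, (1 : ℝ) = 1 := by
    rw [setIntegral_const, volume_real_cell hx.le hy.le, smul_eq_mul, mul_one, ha]
    field_simp
  set U := a * ∫ p in cell lx ly, ‖u p‖ ^ 2
  set G := a * ∫ p in cell lx ly, ‖g p‖ ^ 2
  set H := a * ∫ p in cell lx ly, ‖h p‖ ^ 2
  have hU0 : 0 ≤ U := mul_nonneg ha0.le (integral_nonneg fun p => by positivity)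
  have hG0 : 0 ≤ G := mul_nonneg ha0.le (integral_nonneg fun p => by positivity)
  have iconst : ∀ c : ℝ, IntegrableOn (fun _ : R3 => c) (cell lx ly) := fun c =>
    integrable_const (μ := cellMeasure lx ly) c
  have hwle : ∀ p, u p 2 ^ 2 ≤ ‖u p‖ ^ 2 := fun p => by
    rw [norm_sq_eq]; nlinarith [sq_nonneg (u p 0), sq_nonneg (u p 1)]
  -- A velocity that vanishes almost everywhere carries no flux, so `U > 0` and `κ` below is well
  -- defined.
  have hUpos : 0 < U := by
    refine lt_of_le_of_ne hU0 fun h0 => ?_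
    have h1 : ∫ p in cell lx ly, ‖u p‖ ^ 2 = 0 := by
      rcases mul_eq_zero.1 h0.symm with h | h
      · exact absurd h ha0.ne'
      · exact h
    rw [integral_eq_zero_iff_of_nonneg (fun p => by positivity) iu] at h1
    have h2 : ∫ p in cell lx ly, u p 2 * ξ p = 0 := by
      refine integral_eq_zero_of_ae ?_
      filter_upwards [h1] with p hp
      have h3 : u p 2 = 0 := by
        have h4 := hwle p
        have h5 : ‖u p‖ ^ 2 = 0 := hp
        nlinarith [sq_nonneg (u p 2)]
      simp [h3]
    rw [h2] at hflux
    simp at hflux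
  set s := √U with hs
  have hs0 : 0 < s := Real.sqrt_pos.2 hUpos
  have hsU : s ^ 2 = U := Real.sq_sqrt hU0
  -- With `|κ arctan| ≤ 2κ` and the average of `|w|` at most `√U = s`, the flux lost to truncation
  -- is at most `2κs = 1/2`.
  set κ := 1 / (4 * s) with hκdef
  have hκ : 0 < κ := by positivity
  have iarc : IntegrableOn (fun p => u p 2 * (κ * Real.arctan (ξ p / κ))) (cell lx ly) := by
    refine (hw.integrable one_le_two).mul_bdd (c := 2 * κ) ?_ (ae_of_all _ fun p => ?_)
    · have hc : Continuous fun s : ℝ => κ * Real.arctan (s / κ) := by fun_prop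
      exact hc.comp_aestronglyMeasurable hg.memLp.1
    · exact abs_mul_arctan_le hκ _
  have harc : a * ∫ p in cell lx ly, u p 2 * (κ * Real.arctan (ξ p / κ)) ≤ 1 / 2 := by
    have h1 : ∫ p in cell lx ly, u p 2 * (κ * Real.arctan (ξ p / κ))
        ≤ ∫ p in cell lx ly, (κ * s * 1 + κ / s * ‖u p‖ ^ 2) := by
      refine integral_mono iarc (((iconst 1).const_mul _).add (iu.const_mul _)) fun p => ?_
      have h2 := abs_mul_arctan_le hκ (ξ p)
      have h3 : u p 2 * (κ * Real.arctan (ξ p / κ)) ≤ |u p 2| * (2 * κ) :=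
        (le_abs_self _).trans (by rw [abs_mul]; gcongr)
      -- Pointwise Young inequality with weight `s = √U`; after averaging, both terms equal `s`,
      -- which replaces Cauchy–Schwarz for the integral.
      have h4 : 2 * |u p 2| ≤ s + ‖u p‖ ^ 2 / s := by
        have h5 : |u p 2| ^ 2 ≤ ‖u p‖ ^ 2 := by rw [sq_abs]; exact hwle p
        rw [← sub_nonneg]
        have : s + ‖u p‖ ^ 2 / s - 2 * |u p 2|
            = ((s - |u p 2|) ^ 2 + (‖u p‖ ^ 2 - |u p 2| ^ 2)) / s := by
          field_simp; ring
        rw [this]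
        exact div_nonneg (by nlinarith [sq_nonneg (s - |u p 2|)]) hs0.le
      calc u p 2 * (κ * Real.arctan (ξ p / κ)) ≤ κ * (2 * |u p 2|) := by linarith
        _ ≤ κ * (s + ‖u p‖ ^ 2 / s) := by gcongr
        _ = _ := by ring
    rw [integral_add ((iconst 1).const_mul _) (iu.const_mul _), integral_const_mul,
      integral_const_mul] at h1
    have h2 := mul_le_mul_of_nonneg_left h1 ha0.le
    have h3 : a * (κ * s * (∫ p in cell lx ly, (1 : ℝ)) + κ / s * ∫ p in cell lx ly, ‖u p‖ ^ 2)
        = κ * s * (a * ∫ p in cell lx ly, (1 : ℝ)) + κ / s * U := by ring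
    rw [h3, hone, ← hsU] at h2
    refine h2.trans (le_of_eq ?_)
    rw [hκdef]
    field_simp
    norm_num
  have hflux2 : 1 / 2 ≤ a * ∫ p in cell lx ly, inner ℝ (h p) (tiltGradient (trunc κ) ξ g p) := by
    rw [integral_inner_tiltGradient_eq hκ hu hadm.u_divFree hadm.ξ_bounded hg hζ]
    simp only [mul_sub]
    rw [integral_sub iwξ iarc, mul_sub, hflux]
    linarith
  -- `Γ` is the bound `2 + G/(2κ²)` on the mean square of the tilted gradient. Used as the weight in
  -- Young's inequality, it makes the term not containing `H` at most `Γ/(4Γ) = 1/4`.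
  set Γ := 2 * (1 + 4 * (U * G)) with hΓ
  have hΓ0 : 0 < Γ := by positivity
  have hup : a * ∫ p in cell lx ly, inner ℝ (h p) (tiltGradient (trunc κ) ξ g p)
      ≤ Γ * H + 1 / 4 := by
    have i2 : IntegrableOn (fun p => 1 / (4 * Γ) * 2 * 1
        + 1 / (4 * Γ) * (1 / (2 * κ ^ 2)) * ‖g p‖ ^ 2) (cell lx ly) :=
      ((iconst 1).const_mul _).add (ig.const_mul _)
    have h1 : ∫ p in cell lx ly, inner ℝ (h p) (tiltGradient (trunc κ) ξ g p)
        ≤ ∫ p in cell lx ly, (Γ * ‖h p‖ ^ 2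
          + (1 / (4 * Γ) * 2 * 1 + 1 / (4 * Γ) * (1 / (2 * κ ^ 2)) * ‖g p‖ ^ 2)) := by
      refine integral_mono_ae (integrable_inner_of_memLp hζ.mem_H10.grad_memLp
        (memLp_tiltGradient (contDiff_trunc hκ) (trunc_zero κ)
          (abs_deriv_trunc_le hκ) hg.memLp hg.grad_memLp))
        ((ih.const_mul _).add i2) ?_
      filter_upwards [ae_mem_cell] with p hp
      have h2 := real_inner_le_norm (h p) (tiltGradient (trunc κ) ξ g p)
      have h3 := norm_sq_tiltGradient_le hκ hp (f := ξ) (g := g)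
      set b := ‖tiltGradient (trunc κ) ξ g p‖
      have h4 : ‖h p‖ * b ≤ Γ * ‖h p‖ ^ 2 + 1 / (4 * Γ) * b ^ 2 := by
        rw [← sub_nonneg]
        have : Γ * ‖h p‖ ^ 2 + 1 / (4 * Γ) * b ^ 2 - ‖h p‖ * b
            = (2 * Γ * ‖h p‖ - b) ^ 2 / (4 * Γ) := by
          field_simp; ring
        rw [this]; positivity
      have h5 : 1 / (4 * Γ) * b ^ 2 ≤ 1 / (4 * Γ) * (2 + 1 / (2 * κ ^ 2) * ‖g p‖ ^ 2) := by
        gcongr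
      linarith
    rw [integral_add (ih.const_mul _) i2,
      integral_add ((iconst 1).const_mul _) (ig.const_mul _), integral_const_mul,
      integral_const_mul, integral_const_mul] at h1
    have h2 := mul_le_mul_of_nonneg_left h1 ha0.le
    have h3 : a * (Γ * (∫ p in cell lx ly, ‖h p‖ ^ 2)
        + (1 / (4 * Γ) * 2 * (∫ p in cell lx ly, (1 : ℝ))
          + 1 / (4 * Γ) * (1 / (2 * κ ^ 2)) * ∫ p in cell lx ly, ‖g p‖ ^ 2))
        = Γ * H + 1 / (4 * Γ) * 2 * (a * ∫ p in cell lx ly, (1 : ℝ))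
          + 1 / (4 * Γ) * (1 / (2 * κ ^ 2)) * G := by ring
    rw [h3, hone] at h2
    refine h2.trans (le_of_eq ?_)
    have h4 : 1 / (2 * κ ^ 2) = 8 * U := by
      rw [hκdef, ← hsU]; field_simp; norm_num
    have h5 : Γ = 2 + 8 * U * G := by rw [hΓ]; ring
    rw [h4]
    have h6 : Γ * H + 1 / (4 * Γ) * 2 * 1 + 1 / (4 * Γ) * (8 * U) * G
        = Γ * H + (2 + 8 * U * G) / (4 * Γ) := by ring
    rw [h6, ← h5]
    field_simp
  have h7 : 8 * (1 + 4 * (U * G)) * H = 4 * (Γ * H) := by rw [hΓ]; ring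
  rw [h7]
  linarith

/-- The lower bound on the energy of admissible designs. -/
theorem energy_lower_bound {K : ℝ} (hK : 0 < K) (hx : 0 < lx) (hy : 0 < ly) {ε : ℝ} (hε : 0 < ε)
    (hεK : ε ≤ K) {u : R3 → R3} {ξ : R3 → ℝ} (hadm : IsAdmissible lx ly u ξ) {E : ℝ}
    (hE : HasEnergy lx ly ε u ξ E) : 1 / (16 * (1 + √K)) * √ε ≤ E := by
  obtain ⟨g, ζ, h, hg, hζ, rfl⟩ := hE
  have key := one_le_mul_average_norm_sq hx hy hadm hg hζ
  have nn : ∀ v : R3 → R3, 0 ≤ ⨍ p in cell lx ly, ‖v p‖ ^ 2 := fun v => by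
    rw [setAverage_cell hx.le hy.le]
    exact mul_nonneg (by positivity) (integral_nonneg fun p => by positivity)
  have hU := nn u
  have hG := nn g
  set U := ⨍ p in cell lx ly, ‖u p‖ ^ 2
  set G := ⨍ p in cell lx ly, ‖g p‖ ^ 2
  set H := ⨍ p in cell lx ly, ‖h p‖ ^ 2
  rw [mul_assoc ε]
  have hX : 0 ≤ U * G := mul_nonneg hU hG
  set X := U * G
  set s := √ε with hs
  have hs0 : 0 < s := Real.sqrt_pos.2 hε
  have hsε : ε = s ^ 2 := (Real.sq_sqrt hε.le).symm
  set k := √K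
  have hk0 : 0 < k := Real.sqrt_pos.2 hK
  have hsk : s ≤ k := Real.sqrt_le_sqrt hεK
  have hH : 1 / (8 * (1 + 4 * X)) ≤ H := by
    rw [div_le_iff₀ (by positivity)]; linarith
  rw [hsε]
  refine le_trans ?_ (add_le_add hH le_rfl)
  -- The threshold is where `1` and `4X` balance. Above it `1 + 4X ≤ 8X`, and `1/(64X) + s²X` is
  -- minimized by completing a square. Below it the nonlocal term alone is at least `1/16`, and `s ≤
  -- √K` suffices.
  rcases le_or_gt (1 / 4) X with h4 | h4
  · have h5 : s / 16 ≤ 1 / (8 * (1 + 4 * X)) + s ^ 2 * X := by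
      have h6 : 1 / (8 * (1 + 4 * X)) ≥ 1 / (64 * X) := by
        apply one_div_le_one_div_of_le <;> nlinarith
      have h7 : s / 16 ≤ 1 / (64 * X) + s ^ 2 * X := by
        rw [← sub_nonneg]
        have : 1 / (64 * X) + s ^ 2 * X - s / 16 = ((8 * s * X - 1) ^ 2 + 12 * s * X) / (64 * X) := by
          field_simp; ring
        rw [this]; positivity
      linarith
    refine le_trans ?_ h5
    rw [div_mul_eq_mul_div, one_mul]
    apply div_le_div_of_nonneg_left <;> nlinarith
  · have h6 : 1 / 16 ≤ 1 / (8 * (1 + 4 * X)) := by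
      apply one_div_le_one_div_of_le <;> nlinarith
    have h7 : 1 / (16 * (1 + k)) * s ≤ 1 / 16 := by
      rw [div_mul_eq_mul_div, one_mul, div_le_div_iff₀ (by positivity) (by norm_num)]
      linarith
    have h8 : 0 ≤ s ^ 2 * X := by positivity
    linarith

/-! ### Boundary-layer profiles and cut-offs. -/

/-- A smooth profile of a boundary layer: it vanishes on `(-∞, 1/4]`, equals one on `[1, ∞)`, and
its square has mean one over `[0, 1]`. -/
structure IsLayerProfile (M : ℝ) (η : ℝ → ℝ) : Prop where
  smooth : ContDiff ℝ ∞ η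
  eq_zero : ∀ s ≤ 1 / 4, η s = 0
  eq_one : ∀ s, 1 ≤ s → η s = 1
  bound : ∀ s, |η s| ≤ M
  deriv_bound : ∀ s, |deriv η s| ≤ M
  normalized : ∫ s in (0 : ℝ)..1, η s ^ 2 = 1

/-- A profile rising from zero to one loses mass near the wall, so it must overshoot one to have
mean square one. A bump with amplitude `t` is added to a smooth transition, and `t` comes from the
intermediate value theorem. -/
theorem exists_isLayerProfile : ∃ M η, 1 ≤ M ∧ IsLayerProfile M η := by
  let T := Real.smoothTransition
  let F : ℝ → ℝ → ℝ := fun t s => T (4 * s - 1) + t * (T (4 * s - 1) * T (4 - 4 * s))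
  have hF : ∀ t, ContDiff ℝ ∞ (F t) := fun t => by
    have h1 : ContDiff ℝ ∞ fun s : ℝ => T (4 * s - 1) :=
      Real.smoothTransition.contDiff.comp (by fun_prop)
    have h2 : ContDiff ℝ ∞ fun s : ℝ => T (4 - 4 * s) :=
      Real.smoothTransition.contDiff.comp (by fun_prop)
    exact h1.add (contDiff_const.mul (h1.mul h2))
  have hT0 : ∀ s, s ≤ 0 → T s = 0 := fun s hs => Real.smoothTransition.zero_of_nonpos hs
  have hT1 : ∀ s, 1 ≤ s → T s = 1 := fun s hs => Real.smoothTransition.one_of_one_le hs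
  have hTn : ∀ s, 0 ≤ T s := Real.smoothTransition.nonneg
  have hTl : ∀ s, T s ≤ 1 := Real.smoothTransition.le_one
  have hTc : Continuous T := Real.smoothTransition.continuous
  have hcont : Continuous fun t => ∫ s in (0 : ℝ)..1, F t s ^ 2 := by
    refine intervalIntegral.continuous_parametric_intervalIntegral_of_continuous' ?_ 0 1
    simp only [Function.uncurry_def, F]
    fun_prop
  have hle : ∫ s in (0 : ℝ)..1, F 0 s ^ 2 ≤ 1 := by
    have h := intervalIntegral.integral_mono_on (zero_le_one (α := ℝ))
      (((hF 0).continuous.pow 2).intervalIntegrable 0 1)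
      (continuous_const.intervalIntegrable (μ := volume) 0 1) (g := fun _ => (1 : ℝ))
      (fun s _ => by
        simp only [F, zero_mul, add_zero]
        exact pow_le_one₀ (hTn _) (hTl _))
    simpa using h
  have hge : 1 ≤ ∫ s in (0 : ℝ)..1, F 1 s ^ 2 := by
    -- For `t = 1` both transitions are one here, so `F = 2` and this interval of length `1/4`
    -- already contributes one.
    have h1 : ∫ s in (1 / 2 : ℝ)..(3 / 4), F 1 s ^ 2 = 1 := by
      rw [intervalIntegral.integral_congr (g := fun _ => (4 : ℝ))]
      · simp; norm_num
      · intro s hs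
        rw [uIcc_of_le (by norm_num)] at hs
        have h2 := hT1 (4 * s - 1) (by linarith [hs.1])
        have h3 := hT1 (4 - 4 * s) (by linarith [hs.2])
        simp only [F, h2, h3]; norm_num
    refine h1.symm.le.trans ?_
    exact intervalIntegral.integral_mono_interval (by norm_num) (by norm_num) (by norm_num)
      (ae_of_all _ fun s => sq_nonneg _) (((hF 1).continuous.pow 2).intervalIntegrable 0 1)
  obtain ⟨t, ht, hint⟩ := intermediate_value_Icc zero_le_one hcont.continuousOn ⟨hle, hge⟩
  have h0 : ∀ s ≤ 1 / 4, F t s = 0 := fun s hs => by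
    simp [F, hT0 (4 * s - 1) (by linarith)]
  have h1 : ∀ s, 1 ≤ s → F t s = 1 := fun s hs => by
    simp [F, hT1 (4 * s - 1) (by linarith), hT0 (4 - 4 * s) (by linarith)]
  have hdc : Continuous (deriv (F t)) := continuous_deriv_of_smooth (hF t)
  obtain ⟨D, hD⟩ := (isCompact_Icc (a := (0 : ℝ)) (b := 1)).exists_bound_of_continuousOn
    hdc.continuousOn
  have hD0 : 0 ≤ D := (norm_nonneg _).trans (hD 0 (by simp))
  refine ⟨2 + D, F t, by linarith, hF t, h0, h1, fun s => ?_, fun s => ?_, hint⟩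
  · have e1 := hTn (4 * s - 1)
    have e2 := hTl (4 * s - 1)
    have e3 := hTn (4 - 4 * s)
    have e4 := hTl (4 - 4 * s)
    have e5 : T (4 * s - 1) * T (4 - 4 * s) ≤ 1 := mul_le_one₀ e2 e3 e4
    have e6 : 0 ≤ T (4 * s - 1) * T (4 - 4 * s) := mul_nonneg e1 e3
    have e7 : t * (T (4 * s - 1) * T (4 - 4 * s)) ≤ 1 := mul_le_one₀ ht.2 e6 e5
    have e8 : 0 ≤ t * (T (4 * s - 1) * T (4 - 4 * s)) := mul_nonneg ht.1 e6
    rw [abs_le]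
    constructor <;> simp only [F] <;> linarith
  · by_cases hs : s ∈ Icc (0 : ℝ) 1
    · have := hD s hs
      rw [Real.norm_eq_abs] at this
      linarith
    · have hz : deriv (F t) s = 0 := by
        rcases not_and_or.1 hs with h | h
        · have : F t =ᶠ[𝓝 s] fun _ => 0 := by
            filter_upwards [Iio_mem_nhds (not_le.1 h)] with r hr
            exact h0 r (by linarith [mem_Iio.1 hr])
          rw [this.deriv_eq]; simp
        · have : F t =ᶠ[𝓝 s] fun _ => 1 := by
            filter_upwards [Ioi_mem_nhds (not_le.1 h)] with r hr
            exact h1 r (mem_Ioi.1 hr).le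
          rw [this.deriv_eq]; simp
      rw [hz, abs_zero]; linarith

section Layer

variable {M : ℝ} {η : ℝ → ℝ}

theorem IsLayerProfile.deriv_eq_zero (h : IsLayerProfile M η) {s : ℝ} (hs : 1 ≤ s) :
    deriv η s = 0 := by
  have h2 : ∀ s, 1 < s → deriv η s = 0 := fun s hs => by
    have : η =ᶠ[𝓝 s] fun _ => 1 := by
      filter_upwards [Ioi_mem_nhds hs] with r hr using h.eq_one r (mem_Ioi.1 hr).le
    rw [this.deriv_eq]; simp
  have hc := continuous_deriv_of_smooth h.smooth
  have hcl : IsClosed {s | deriv η s = 0} := isClosed_eq hc continuous_const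
  have : closure (Ioi (1 : ℝ)) ⊆ {s | deriv η s = 0} :=
    hcl.closure_subset_iff.2 fun s hs => h2 s hs
  rw [closure_Ioi] at this
  exact this hs

/-- The two-sided cut-off with boundary layers of thickness `δ`. -/
noncomputable def layerCutoff (η : ℝ → ℝ) (δ z : ℝ) : ℝ := η (z / δ) * η ((1 - z) / δ)

theorem IsLayerProfile.contDiff_layerCutoff (h : IsLayerProfile M η) (δ : ℝ) :
    ContDiff ℝ ∞ (layerCutoff η δ) :=
  (h.smooth.comp (contDiff_id.div_const δ)).mul
    (h.smooth.comp ((contDiff_const.sub contDiff_id).div_const δ))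

theorem IsLayerProfile.hasDerivAt_layerCutoff (h : IsLayerProfile M η) (δ z : ℝ) :
    HasDerivAt (layerCutoff η δ)
      (deriv η (z / δ) / δ * η ((1 - z) / δ) - η (z / δ) * (deriv η ((1 - z) / δ) / δ)) z := by
  have hd : ∀ s, HasDerivAt η (deriv η s) s := fun s =>
    (h.smooth.differentiable (by simp) s).hasDerivAt
  have h1 := (hd (z / δ)).comp z ((hasDerivAt_id z).div_const δ)
  have h2 := (hd ((1 - z) / δ)).comp z (((hasDerivAt_id z).const_sub 1).div_const δ)
  refine (h1.mul h2).congr_deriv ?_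
  simp only [Function.comp_apply, id]
  ring

theorem IsLayerProfile.layerCutoff_eq_zero (h : IsLayerProfile M η) {δ : ℝ} (hδ : 0 < δ) {z : ℝ}
    (hz : z ∉ Icc (δ / 4) (1 - δ / 4)) : layerCutoff η δ z = 0 := by
  rw [mem_Icc, not_and_or, not_le, not_le] at hz
  rcases hz with hz | hz
  · rw [layerCutoff, h.eq_zero (z / δ), zero_mul]
    rw [div_le_iff₀ hδ]; linarith
  · rw [layerCutoff, h.eq_zero ((1 - z) / δ), mul_zero]
    rw [div_le_iff₀ hδ]; linarith

theorem IsLayerProfile.layerCutoff_eq_one (h : IsLayerProfile M η) {δ : ℝ} (hδ : 0 < δ) {z : ℝ}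
    (hz : z ∈ Icc δ (1 - δ)) : layerCutoff η δ z = 1 := by
  rw [layerCutoff, h.eq_one (z / δ), h.eq_one ((1 - z) / δ), mul_one]
  · rw [le_div_iff₀ hδ]; linarith [hz.2]
  · rw [le_div_iff₀ hδ]; linarith [hz.1]

theorem layerCutoff_one_sub (η : ℝ → ℝ) (δ z : ℝ) :
    layerCutoff η δ (1 - z) = layerCutoff η δ z := by
  simp [layerCutoff, mul_comm]

theorem IsLayerProfile.integral_layerCutoff_sq (h : IsLayerProfile M η) {δ : ℝ} (hδ : 0 < δ)
    (hδ2 : δ < 1 / 2) : ∫ z in (0 : ℝ)..1, layerCutoff η δ z ^ 2 = 1 := by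
  have hc : Continuous fun z => layerCutoff η δ z ^ 2 := (h.contDiff_layerCutoff δ).continuous.pow 2
  have hη : Continuous fun s => η s ^ 2 := h.smooth.continuous.pow 2
  have h1 : ∫ z in (0 : ℝ)..(1 / 2), layerCutoff η δ z ^ 2 = 1 / 2 := by
    rw [intervalIntegral.integral_congr (g := fun z => η (z / δ) ^ 2)]
    -- Rescaled, the half integral is `δ (1 + (1/(2δ) - 1)) = 1/2`: the layer has the same mean
    -- square as the bulk, whatever `δ` is.
    · rw [intervalIntegral.integral_comp_div (fun s => η s ^ 2) hδ.ne', zero_div,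
        ← intervalIntegral.integral_add_adjacent_intervals (hη.intervalIntegrable 0 1)
          (hη.intervalIntegrable 1 _), h.normalized,
        intervalIntegral.integral_congr (a := 1) (g := fun _ => (1 : ℝ))]
      · simp; field_simp
      · intro s hs
        rw [uIcc_of_le (by rw [le_div_iff₀ hδ]; linarith)] at hs
        simp [h.eq_one s hs.1]
    · intro z hz
      rw [uIcc_of_le (by norm_num)] at hz
      simp only [layerCutoff]
      rw [h.eq_one ((1 - z) / δ), mul_one]
      rw [le_div_iff₀ hδ]; linarith [hz.2]
  have h2 : ∫ z in (1 / 2 : ℝ)..1, layerCutoff η δ z ^ 2 = 1 / 2 := by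
    have h3 := intervalIntegral.integral_comp_sub_left (a := 0) (b := 1 / 2)
      (fun z => layerCutoff η δ z ^ 2) 1
    simp only [layerCutoff_one_sub, h1] at h3
    rw [sub_zero, show (1 : ℝ) - 1 / 2 = 1 / 2 by norm_num] at h3
    exact h3.symm
  rw [← intervalIntegral.integral_add_adjacent_intervals (hc.intervalIntegrable 0 (1 / 2))
    (hc.intervalIntegrable _ 1), h1, h2]
  norm_num

theorem IsLayerProfile.isCutoff (h : IsLayerProfile M η) (hM : 1 ≤ M) {δ : ℝ} (hδ : 0 < δ)
    (hδ2 : δ < 1 / 2) : IsCutoff (2 * M ^ 2) δ (layerCutoff η δ) where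
  smooth := h.contDiff_layerCutoff δ
  support := by
    have hsub : tsupport (layerCutoff η δ) ⊆ Icc (δ / 4) (1 - δ / 4) :=
      closure_minimal (fun z hz => by_contra fun hn => hz (h.layerCutoff_eq_zero hδ hn)) isClosed_Icc
    exact hsub.trans (Icc_subset_Ioo (by linarith) (by linarith))
  eq_one z hz := h.layerCutoff_eq_one hδ hz
  bound z := by
    rw [layerCutoff, abs_mul]
    nlinarith [h.bound (z / δ), h.bound ((1 - z) / δ), abs_nonneg (η (z / δ)),
      abs_nonneg (η ((1 - z) / δ))]
  deriv_bound z := by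
    rw [(h.hasDerivAt_layerCutoff δ z).deriv]
    have e : deriv η (z / δ) / δ * η ((1 - z) / δ) - η (z / δ) * (deriv η ((1 - z) / δ) / δ)
        = (deriv η (z / δ) * η ((1 - z) / δ) - η (z / δ) * deriv η ((1 - z) / δ)) / δ := by ring
    rw [e, abs_div, abs_of_pos hδ]
    refine div_le_div_of_nonneg_right ((abs_sub _ _).trans ?_) hδ.le
    rw [abs_mul, abs_mul]
    have h1 := mul_le_mul (h.deriv_bound (z / δ)) (h.bound ((1 - z) / δ)) (abs_nonneg _)
      (by linarith)
    have h2 := mul_le_mul (h.bound (z / δ)) (h.deriv_bound ((1 - z) / δ)) (abs_nonneg _)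
      (by linarith)
    linarith
  normalized := h.integral_layerCutoff_sq hδ hδ2

/-- Scale-invariant: at `s = z/δ` it says that the slope of the cut-off times the distance to the
wall is bounded uniformly in `δ`. -/
theorem IsLayerProfile.abs_mul_deriv_le (h : IsLayerProfile M η) {s : ℝ} (hs : 0 ≤ s) :
    s * |deriv η s| ≤ M := by
  have hM : 0 ≤ M := (abs_nonneg _).trans (h.bound 0)
  rcases le_total 1 s with h1 | h1
  · simpa [h.deriv_eq_zero h1] using hM
  · nlinarith [h.deriv_bound s, abs_nonneg (deriv η s)]

end Layer

/-! ### Membership in `H¹₀` and fields given by streamfunctions. -/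

theorem ae_coord_ne (i : Fin 3) (c : ℝ) : ∀ᵐ p ∂(cellMeasure lx ly), p i ≠ c := by
  refine ae_restrict_of_ae ?_
  have h : ∀ᵐ y : Fin 3 → ℝ, y i ≠ c :=
    Measure.ae_eval_ne (fun _ => (volume : Measure ℝ)) i c
  exact (PiLp.volume_preserving_ofLp (Fin 3)).quasiMeasurePreserving.ae h

theorem isTestFunction_mul_coord {b a : ℝ → ℝ} (hb : ContDiff ℝ ∞ b) (ha : ContDiff ℝ ∞ a)
    (hper : ∀ x, a (x + lx) = a x) (hsupp : ∃ r > 0, ∀ z, z ∉ Icc r (1 - r) → b z = 0) :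
    IsTestFunction lx ly (fun p => b (p 2) * a (p 0)) where
  smooth := (hb.comp (contDiff_coord 2)).mul (ha.comp (contDiff_coord 0))
  periodic_x p := by simp [hper]
  periodic_y p := by simp
  vanishes_near_walls := by
    obtain ⟨r, hr, h⟩ := hsupp
    exact ⟨r, hr, fun p hp => by simp [h _ hp]⟩

/-- Smooth functions of `z` that vanish at the walls are in `H¹₀`. -/
theorem hasH10Gradient_of_coord {f : ℝ → ℝ} (hf : ContDiff ℝ ∞ f) (h0 : f 0 = 0) (h1 : f 1 = 0) :
    HasH10Gradient lx ly (fun p => f (p 2)) (fun p => !₂[0, 0, deriv f (p 2)]) := by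
  have hfd : ∀ z, HasDerivAt f (deriv f z) z := fun z =>
    (hf.differentiable (by simp) z).hasDerivAt
  have hgr : (fun p : R3 => !₂[0, 0, deriv f (p 2)]) = gradient fun p : R3 => f (p 2) := by
    funext p; exact (gradient_coord (hfd _)).symm
  have hf3 : ContDiff ℝ ∞ fun p : R3 => f (p 2) := hf.comp (contDiff_coord 2)
  rw [hgr]
  refine ⟨memLp_cell_of_continuous hf3.continuous 2,
    memLp_cell_of_continuous (continuous_gradient hf3) 2, ?_⟩
  obtain ⟨M, η, hM, h⟩ := exists_isLayerProfile
  have hM0 : 0 ≤ M := by linarith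
  let N : ℕ → ℝ := fun n => 1 / ((n : ℝ) + 1)
  have hN : ∀ n, 0 < N n := fun n => Nat.one_div_pos_of_nat
  have hNlim : Tendsto N atTop (𝓝 0) := tendsto_one_div_add_atTop_nhds_zero_nat
  let b : ℕ → ℝ → ℝ := fun n z => layerCutoff η (N n) z * f z
  have hb : ∀ n, ContDiff ℝ ∞ (b n) := fun n => (h.contDiff_layerCutoff _).mul hf
  have htest : ∀ n, IsTestFunction lx ly (fun p => b n (p 2)) := fun n => by
    have := isTestFunction_mul_coord (lx := lx) (ly := ly) (hb n) (contDiff_const (c := (1 : ℝ)))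
      (fun _ => rfl) ⟨N n / 4, by have := hN n; positivity, fun z hz => by
        simp only [b]; rw [h.layerCutoff_eq_zero (hN n) hz, zero_mul]⟩
    simpa using this
  obtain ⟨L, hL⟩ := (isCompact_Icc (a := (0 : ℝ)) (b := 1)).exists_bound_of_continuousOn
    (continuous_deriv_of_smooth hf).continuousOn
  have hL0 : 0 ≤ L := (norm_nonneg _).trans (hL 0 (by simp))
  have hlip : ∀ z ∈ Icc (0 : ℝ) 1, ∀ w ∈ Icc (0 : ℝ) 1, |f z - f w| ≤ L * |z - w| :=
    fun z hz w hw => (convex_Icc (0 : ℝ) 1).norm_image_sub_le_of_norm_deriv_le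
      (fun x _ => hf.differentiable (by simp) x) hL hw hz
  have hcut : ∀ n z, |layerCutoff η (N n) z| ≤ M ^ 2 := fun n z => by
    rw [layerCutoff, abs_mul, sq]
    exact mul_le_mul (h.bound _) (h.bound _) (abs_nonneg _) hM0
  -- The cut-off has slope of order `1/N n`, but `f` is at most `L` times the distance to each wall,
  -- so the product stays bounded. This uniform bound is the dominating function for the gradients;
  -- pointwise, `b n` eventually agrees with `f` near each interior point.
  have hder : ∀ n z, z ∈ Icc (0 : ℝ) 1 → |deriv (b n) z| ≤ 3 * (L * M ^ 2) := fun n z hz => by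
    have hn := hN n
    have hd : HasDerivAt (b n) _ z := (h.hasDerivAt_layerCutoff (N n) z).mul (hfd z)
    rw [hd.deriv]
    have z1 : |f z| ≤ L * z := by
      have := hlip z hz 0 (by simp)
      rwa [h0, sub_zero, sub_zero, abs_of_nonneg hz.1] at this
    have z2 : |f z| ≤ L * (1 - z) := by
      have := hlip z hz 1 (by simp)
      rwa [h1, sub_zero, abs_sub_comm z,
        abs_of_nonneg (sub_nonneg.2 hz.2)] at this
    have e1 := h.abs_mul_deriv_le (s := z / N n) (div_nonneg hz.1 hn.le)
    have e2 := h.abs_mul_deriv_le (s := (1 - z) / N n) (div_nonneg (by linarith [hz.2]) hn.le)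
    have t1 : |deriv η (z / N n) / N n * η ((1 - z) / N n) * f z| ≤ L * M ^ 2 := by
      rw [abs_mul, abs_mul, abs_div, abs_of_pos hn]
      calc |deriv η (z / N n)| / N n * |η ((1 - z) / N n)| * |f z|
          ≤ |deriv η (z / N n)| / N n * M * (L * z) := by
            gcongr
            exact h.bound _
        _ = z / N n * |deriv η (z / N n)| * (M * L) := by ring
        _ ≤ M * (M * L) := by gcongr
        _ = _ := by ring
    have t2 : |η (z / N n) * (deriv η ((1 - z) / N n) / N n) * f z| ≤ L * M ^ 2 := by
      rw [abs_mul, abs_mul, abs_div, abs_of_pos hn]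
      calc |η (z / N n)| * (|deriv η ((1 - z) / N n)| / N n) * |f z|
          ≤ M * (|deriv η ((1 - z) / N n)| / N n) * (L * (1 - z)) := by
            gcongr
            exact h.bound _
        _ = (1 - z) / N n * |deriv η ((1 - z) / N n)| * (M * L) := by ring
        _ ≤ M * (M * L) := by gcongr
        _ = _ := by ring
    have t3 : |layerCutoff η (N n) z * deriv f z| ≤ L * M ^ 2 := by
      rw [abs_mul, mul_comm L]
      exact mul_le_mul (hcut n z) (hL z hz) (abs_nonneg _) (by positivity)
    rw [sub_mul]
    refine (abs_add_le _ _).trans ?_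
    linarith [abs_sub (deriv η (z / N n) / N n * η ((1 - z) / N n) * f z)
      (η (z / N n) * (deriv η ((1 - z) / N n) / N n) * f z)]
  have hev : ∀ z ∈ Ioo (0 : ℝ) 1, ∀ᶠ n in atTop, b n =ᶠ[𝓝 z] f := fun z hz => by
    have hlt : 0 < min z (1 - z) := lt_min hz.1 (by linarith [hz.2])
    filter_upwards [hNlim.eventually_lt_const hlt] with n hn
    have hm : Icc (N n) (1 - N n) ∈ 𝓝 z := by
      rw [lt_min_iff] at hn
      exact Icc_mem_nhds hn.1 (by linarith [hn.2])
    filter_upwards [hm] with w hw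
    simp only [b]
    rw [h.layerCutoff_eq_one (hN n) hw, one_mul]
  have hae : ∀ᵐ p ∂(cellMeasure lx ly), p 2 ∈ Ioo (0 : ℝ) 1 := by
    filter_upwards [ae_mem_cell, ae_coord_ne 2 0, ae_coord_ne 2 1] with p hp hp0 hp1
    exact ⟨lt_of_le_of_ne hp.2.2.1 hp0.symm, lt_of_le_of_ne hp.2.2.2 hp1⟩
  have hgb : ∀ n (p : R3), gradient (fun p : R3 => b n (p 2)) p = !₂[0, 0, deriv (b n) (p 2)] :=
    fun n p => gradient_coord ((hb n).differentiable (by simp) _).hasDerivAt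
  have hgf : ∀ p : R3, gradient (fun p : R3 => f (p 2)) p = !₂[0, 0, deriv f (p 2)] :=
    fun p => gradient_coord (hfd _)
  refine ⟨fun n p => b n (p 2), htest, ?_, ?_⟩
  · refine tendsto_eLpNorm_two_zero_of_dominated (G := fun _ => L * M ^ 2 + L)
      (fun n => ((htest n).smooth.continuous.sub hf3.continuous).aestronglyMeasurable)
      (memLp_const _) (fun n => ?_) ?_
    · filter_upwards [ae_mem_cell] with p hp
      have hz := hp.2.2
      have z1 : |f (p 2)| ≤ L := by
        have := hlip _ hz 0 (by simp)
        rw [h0, sub_zero, sub_zero, abs_of_nonneg hz.1] at this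
        nlinarith [hz.2]
      refine (norm_sub_le _ _).trans (add_le_add ?_ z1)
      simp only [b, norm_mul, Real.norm_eq_abs]
      rw [mul_comm L]
      exact mul_le_mul (hcut n _) z1 (abs_nonneg _) (by positivity)
    · filter_upwards [hae] with p hp
      refine tendsto_const_nhds.congr' ?_
      filter_upwards [hev _ hp] with n hn
      rw [hn.eq_of_nhds, sub_self]
  · refine tendsto_eLpNorm_two_zero_of_dominated (G := fun _ => 3 * (L * M ^ 2) + L)
      (fun n => ((continuous_gradient (htest n).smooth).sub
        (continuous_gradient hf3)).aestronglyMeasurable)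
      (memLp_const _) (fun n => ?_) ?_
    · filter_upwards [ae_mem_cell] with p hp
      have nrm : ∀ c : ℝ, ‖(!₂[0, 0, c] : R3)‖ = |c| := fun c => by
        rw [EuclideanSpace.norm_eq]; simp [Fin.sum_univ_three, Real.sqrt_sq_eq_abs]
      rw [hgb, hgf]
      refine (norm_sub_le _ _).trans ?_
      rw [nrm, nrm]
      exact add_le_add (hder n _ hp.2.2) (hL _ hp.2.2)
    · filter_upwards [hae] with p hp
      refine tendsto_const_nhds.congr' ?_
      filter_upwards [hev _ hp] with n hn
      rw [hgb, hgf, hn.deriv_eq, sub_self]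

/-- Smooth compactly supported functions are in `H¹₀`. -/
theorem IsTestFunction.hasH10Gradient {f : R3 → ℝ} (hf : IsTestFunction lx ly f) :
    HasH10Gradient lx ly f (gradient f) where
  memLp := memLp_cell_of_continuous hf.smooth.continuous 2
  grad_memLp := memLp_cell_of_continuous (continuous_gradient hf.smooth) 2
  approx := ⟨fun _ => f, fun _ => hf, by simp, by simp⟩

theorem integrableOn_cell_of_continuous {f : R3 → ℝ} (hf : Continuous f) :
    IntegrableOn f (cell lx ly) :=
  hf.continuousOn.integrableOn_compact (isCompact_cell lx ly)

theorem IsTestFunction.eq_zero_of_wall {φ : R3 → ℝ} (hφ : IsTestFunction lx ly φ) {p : R3}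
    (hp : p 2 = 0 ∨ p 2 = 1) : φ p = 0 := by
  obtain ⟨a, ha, h⟩ := hφ.vanishes_near_walls
  refine h p fun hm => ?_
  rcases hp with hp | hp <;> rw [hp] at hm <;> linarith [hm.1, hm.2]

/-- A function vanishing at the walls has a `z`-derivative of mean zero. -/
theorem integral_cell_partial_z_eq_zero (hx : 0 ≤ lx) (hy : 0 ≤ ly) {f : R3 → ℝ}
    (hf : ContDiff ℝ 1 f) (h0 : ∀ p : R3, p 2 = 0 ∨ p 2 = 1 → f p = 0) :
    ∫ p in cell lx ly, fderiv ℝ f p (EuclideanSpace.single 2 1) = 0 := by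
  refine integral_cell_partial_eq_zero hx hy 2 hf fun p hp => ?_
  rw [h0 p (Or.inl hp), h0 _ (Or.inr _)]
  simp [hp]

theorem integral_cell_partial_x_eq_zero (hx : 0 ≤ lx) (hy : 0 ≤ ly) {f : R3 → ℝ}
    (hf : ContDiff ℝ 1 f) (hper : ∀ p, f (p + EuclideanSpace.single 0 lx) = f p) :
    ∫ p in cell lx ly, fderiv ℝ f p (EuclideanSpace.single 0 1) = 0 :=
  integral_cell_partial_eq_zero hx hy 0 hf fun p _ => hper p

/-- The planar velocity field with a streamfunction that vanishes near the walls is divergence-free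
with zero normal trace. -/
theorem integral_inner_streamfunction_eq_zero (hx : 0 ≤ lx) (hy : 0 ≤ ly) {P φ : R3 → ℝ}
    (hP : IsTestFunction lx ly P) (hφ : IsSmoothPeriodic lx ly φ) :
    ∫ p in cell lx ly,
      inner ℝ (!₂[-(gradient P p 2), 0, gradient P p 0] : R3) (gradient φ p) = 0 := by
  have hPd : ∀ p, HasFDerivAt P (fderiv ℝ P p) p := fun p =>
    (hP.smooth.differentiable (by simp) p).hasFDerivAt
  have hφ' : ContDiff ℝ ∞ (fderiv ℝ φ) := hφ.smooth.fderiv_right le_rfl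
  have hv : ∀ v, ContDiff ℝ ∞ fun p => fderiv ℝ φ p v := fun v => hφ'.clm_apply contDiff_const
  have hvd : ∀ v p, HasFDerivAt (fun q => fderiv ℝ φ q v)
      ((fderiv ℝ (fderiv ℝ φ) p).flip v) p := fun v p => by
    have h1 := (hφ'.differentiable (by simp) p).hasFDerivAt.clm_apply (hasFDerivAt_const v p)
    refine h1.congr_fderiv ?_
    ext w; simp
  have hper : ∀ v p, fderiv ℝ φ (p + EuclideanSpace.single 0 lx) v = fderiv ℝ φ p v := fun v p => by
    have h1 : (fun q => φ (q + EuclideanSpace.single 0 lx)) = φ := funext hφ.periodic_x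
    rw [← fderiv_comp_add_right, h1]
  set ex : R3 := EuclideanSpace.single 0 1 with hex
  set ez : R3 := EuclideanSpace.single 2 1 with hez
  have hc1 : ContDiff ℝ 1 fun p => P p * fderiv ℝ φ p ez :=
    (hP.smooth.mul (hv ez)).of_le (by exact_mod_cast le_top)
  have hc2 : ContDiff ℝ 1 fun p => P p * fderiv ℝ φ p ex :=
    (hP.smooth.mul (hv ex)).of_le (by exact_mod_cast le_top)
  have i1 := integral_cell_partial_x_eq_zero hx hy hc1 fun p => by
    rw [hP.periodic_x, hper]
  have i2 := integral_cell_partial_z_eq_zero hx hy hc2 fun p hp => by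
    rw [hP.eq_zero_of_wall hp, zero_mul]
  have c1 : Continuous fun p => fderiv ℝ (fun p => P p * fderiv ℝ φ p ez) p ex :=
    (hc1.continuous_fderiv one_ne_zero).clm_apply continuous_const
  have c2 : Continuous fun p => fderiv ℝ (fun p => P p * fderiv ℝ φ p ex) p ez :=
    (hc2.continuous_fderiv one_ne_zero).clm_apply continuous_const
  -- The integrand is `∂ₓ(P ∂_z φ) - ∂_z(P ∂ₓ φ)`, since the mixed derivatives of `φ` cancel. The
  -- first term integrates to zero by periodicity, the second because `P` vanishes at the walls.
  have key := integral_sub (integrableOn_cell_of_continuous (lx := lx) (ly := ly) c1)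
    (integrableOn_cell_of_continuous c2)
  rw [i1, i2, sub_zero] at key
  refine Eq.trans (integral_congr_ae (ae_of_all _ fun p => ?_)) key
  have e1 : fderiv ℝ (fun p => P p * fderiv ℝ φ p ez) p = _ := ((hPd p).mul (hvd ez p)).fderiv
  have e2 : fderiv ℝ (fun p => P p * fderiv ℝ φ p ex) p = _ := ((hPd p).mul (hvd ex p)).fderiv
  have hsymm : fderiv ℝ (fderiv ℝ φ) p ex ez = fderiv ℝ (fderiv ℝ φ) p ez ex :=
    (hφ.smooth.contDiffAt.isSymmSndFDerivAt
      (by simpa using (WithTop.coe_le_coe.2 le_top : ((2 : ℕ∞) : WithTop ℕ∞) ≤ ∞))).eq ex ez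
  simp only [inner_eq, gradient_apply, e1, e2, ← hex, ← hez]
  simp [hsymm]
  ring

/-! ### Convection rolls: admissibility and exact energy. -/

theorem rollProfile_hasDerivAt (x : ℝ) : HasDerivAt rollProfile (-(√2 * Real.sin x)) x := by
  have h := (Real.hasDerivAt_cos x).const_mul √2
  rw [mul_neg] at h
  exact h

theorem deriv_rollProfile : deriv rollProfile = fun x => -(√2 * Real.sin x) :=
  funext fun x => (rollProfile_hasDerivAt x).deriv

/-- The boundary-layer function `∫₀ᶻ (χ² - 1)`. -/
noncomputable def layerPotential (χ : ℝ → ℝ) (z : ℝ) : ℝ := ∫ t in (0 : ℝ)..z, (χ t ^ 2 - 1)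

section Roll

variable {M δ : ℝ} {χ : ℝ → ℝ} {l : ℝ} {k : ℕ}

theorem IsCutoff.hasDerivAt (h : IsCutoff M δ χ) (z : ℝ) : HasDerivAt χ (deriv χ z) z :=
  (h.smooth.differentiable (by simp) z).hasDerivAt

theorem IsCutoff.exists_vanishing (h : IsCutoff M δ χ) :
    ∃ r > 0, ∀ z, z ∉ Icc r (1 - r) → χ z = 0 := by
  have hc : IsCompact (tsupport χ) :=
    isCompact_Icc.of_isClosed_subset (isClosed_tsupport χ) (h.support.trans Ioo_subset_Icc_self)
  rcases (tsupport χ).eq_empty_or_nonempty with he | hne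
  · refine ⟨1, one_pos, fun z _ => image_eq_zero_of_notMem_tsupport ?_⟩
    rw [he]; exact notMem_empty z
  · obtain ⟨a, ha, hamin⟩ := hc.exists_isLeast hne
    obtain ⟨b, hb, hbmax⟩ := hc.exists_isGreatest hne
    have ha1 := h.support ha
    have hb1 := h.support hb
    refine ⟨min a (1 - b), lt_min ha1.1 (by linarith [hb1.2]), fun z hz =>
      image_eq_zero_of_notMem_tsupport fun hm => hz ⟨?_, ?_⟩⟩
    · exact (min_le_left _ _).trans (hamin hm)
    · have := min_le_right a (1 - b)
      linarith [hbmax hm]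

theorem IsCutoff.layerPotential_hasDerivAt (h : IsCutoff M δ χ) (z : ℝ) :
    HasDerivAt (layerPotential χ) (χ z ^ 2 - 1) z := by
  have hc : Continuous fun t => χ t ^ 2 - 1 := (h.smooth.continuous.pow 2).sub continuous_const
  exact intervalIntegral.integral_hasDerivAt_right (hc.intervalIntegrable _ _)
    (hc.stronglyMeasurableAtFilter _ _) hc.continuousAt

theorem IsCutoff.deriv_layerPotential (h : IsCutoff M δ χ) :
    deriv (layerPotential χ) = fun z => χ z ^ 2 - 1 :=
  funext fun z => (h.layerPotential_hasDerivAt z).deriv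

theorem IsCutoff.contDiff_layerPotential (h : IsCutoff M δ χ) :
    ContDiff ℝ ∞ (layerPotential χ) := by
  rw [contDiff_infty_iff_deriv, h.deriv_layerPotential]
  exact ⟨fun z => (h.layerPotential_hasDerivAt z).differentiableAt,
    (h.smooth.pow 2).sub contDiff_const⟩

/-- The normalization `∫ χ² = 1` is what makes the potential vanish at the upper wall as well. -/
theorem IsCutoff.hasH10Gradient_layerPotential (h : IsCutoff M δ χ) :
    HasH10Gradient lx ly (fun p => layerPotential χ (p 2)) (fun p => !₂[0, 0, χ (p 2) ^ 2 - 1]) := by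
  have h1 : layerPotential χ 1 = 0 := by
    have hc : Continuous fun t => χ t ^ 2 := h.smooth.continuous.pow 2
    rw [layerPotential, intervalIntegral.integral_sub (hc.intervalIntegrable _ _)
      (continuous_const.intervalIntegrable _ _), h.normalized]
    simp
  have := hasH10Gradient_of_coord (lx := lx) (ly := ly) h.contDiff_layerPotential
    (by simp [layerPotential]) h1
  simpa only [h.deriv_layerPotential] using this

theorem hasDerivAt_cos_div (c l x : ℝ) :
    HasDerivAt (fun x => c * Real.cos (x / l)) (-(c / l * Real.sin (x / l))) x := by
  have h1 := (((hasDerivAt_id x).div_const l).cos).const_mul c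
  refine h1.congr_deriv ?_
  simp only [id]; ring

theorem hasDerivAt_sin_div (c l x : ℝ) :
    HasDerivAt (fun x => c * Real.sin (x / l)) (c / l * Real.cos (x / l)) x := by
  have h1 := (((hasDerivAt_id x).div_const l).sin).const_mul c
  refine h1.congr_deriv ?_
  simp only [id]; ring

theorem rollStream_eq (χ : ℝ → ℝ) (l : ℝ) :
    rollStream χ l = fun p => χ (p 2) * ((fun x => √l * √2 * Real.cos (x / l)) (p 0)) := by
  funext p; simp only [rollStream, rollProfile]; ring

theorem rollTest_eq (χ : ℝ → ℝ) (l : ℝ) :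
    rollTest χ l = fun p => χ (p 2) * ((fun x => -(√l * √2) * Real.sin (x / l)) (p 0)) := by
  funext p; simp only [rollTest, deriv_rollProfile]; ring

theorem IsCutoff.rollVelocity_eq (h : IsCutoff M δ χ) (l : ℝ) (p : R3) :
    rollVelocity χ l p = !₂[-(deriv χ (p 2) * (√l * √2 * Real.cos (p 0 / l))), 0,
      χ (p 2) * -(√l * √2 / l * Real.sin (p 0 / l))] := by
  rw [rollVelocity, rollStream_eq,
    gradient_mul_coord (h.hasDerivAt _) (hasDerivAt_cos_div (√l * √2) l (p 0))]
  simp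

theorem IsCutoff.gradient_rollTest (h : IsCutoff M δ χ) (l : ℝ) (p : R3) :
    gradient (rollTest χ l) p = !₂[χ (p 2) * (-(√l * √2) / l * Real.cos (p 0 / l)), 0,
      deriv χ (p 2) * (-(√l * √2) * Real.sin (p 0 / l))] := by
  rw [rollTest_eq, gradient_mul_coord (h.hasDerivAt _) (hasDerivAt_sin_div (-(√l * √2)) l (p 0))]

theorem div_period_eq (hx : 0 < lx) (hk : 1 / l = 2 * Real.pi / lx * k) :
    lx / l = k * (2 * Real.pi) := by
  rw [div_eq_mul_one_div, hk]; field_simp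

theorem cos_div_add_period (hx : 0 < lx) (hk : 1 / l = 2 * Real.pi / lx * k) (x : ℝ) :
    Real.cos ((x + lx) / l) = Real.cos (x / l) := by
  rw [add_div, div_period_eq hx hk, Real.cos_add_nat_mul_two_pi]

theorem sin_div_add_period (hx : 0 < lx) (hk : 1 / l = 2 * Real.pi / lx * k) (x : ℝ) :
    Real.sin ((x + lx) / l) = Real.sin (x / l) := by
  rw [add_div, div_period_eq hx hk, Real.sin_add_nat_mul_two_pi]

theorem IsCutoff.isTestFunction_rollStream (h : IsCutoff M δ χ) (hx : 0 < lx)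
    (hk : 1 / l = 2 * Real.pi / lx * k) : IsTestFunction lx ly (rollStream χ l) := by
  rw [rollStream_eq]
  exact isTestFunction_mul_coord h.smooth (contDiff_const.mul (contDiff_id.div_const l).cos)
    (fun x => by simp only [id, cos_div_add_period hx hk]) h.exists_vanishing

theorem IsCutoff.isTestFunction_rollTest (h : IsCutoff M δ χ) (hx : 0 < lx)
    (hk : 1 / l = 2 * Real.pi / lx * k) : IsTestFunction lx ly (rollTest χ l) := by
  rw [rollTest_eq]
  exact isTestFunction_mul_coord h.smooth (contDiff_const.mul (contDiff_id.div_const l).sin)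
    (fun x => by simp only [id, sin_div_add_period hx hk]) h.exists_vanishing

theorem integral_two_cos_sq (hl : 0 < l) (hx : 0 < lx) (hk : 1 / l = 2 * Real.pi / lx * k) :
    ∫ x in (0 : ℝ)..lx, 2 * Real.cos (x / l) ^ 2 = lx := by
  have hs : Real.sin (lx / l) = 0 := by
    rw [div_period_eq hx hk]
    simpa using Real.sin_add_nat_mul_two_pi 0 k
  rw [intervalIntegral.integral_const_mul,
    intervalIntegral.integral_comp_div (fun x => Real.cos x ^ 2) hl.ne', integral_cos_sq, hs]
  simp
  field_simp

theorem integral_two_sin_sq (hl : 0 < l) (hx : 0 < lx) (hk : 1 / l = 2 * Real.pi / lx * k) :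
    ∫ x in (0 : ℝ)..lx, 2 * Real.sin (x / l) ^ 2 = lx := by
  have hs : Real.sin (lx / l) = 0 := by
    rw [div_period_eq hx hk]
    simpa using Real.sin_add_nat_mul_two_pi 0 k
  rw [intervalIntegral.integral_const_mul,
    intervalIntegral.integral_comp_div (fun x => Real.sin x ^ 2) hl.ne', integral_sin_sq, hs]
  simp
  field_simp

theorem average_two_cos_sq_mul (hl : 0 < l) (hx : 0 < lx) (hy : 0 < ly)
    (hk : 1 / l = 2 * Real.pi / lx * k) (g : ℝ → ℝ) :
    (lx * ly)⁻¹ * ∫ p in cell lx ly, 2 * Real.cos (p 0 / l) ^ 2 * g (p 2)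
      = ∫ z in (0 : ℝ)..1, g z := by
  rw [integral_cell_prod hx.le hy.le (fun x => 2 * Real.cos (x / l) ^ 2) g,
    integral_two_cos_sq hl hx hk]
  field_simp

theorem average_two_sin_sq_mul (hl : 0 < l) (hx : 0 < lx) (hy : 0 < ly)
    (hk : 1 / l = 2 * Real.pi / lx * k) (g : ℝ → ℝ) :
    (lx * ly)⁻¹ * ∫ p in cell lx ly, 2 * Real.sin (p 0 / l) ^ 2 * g (p 2)
      = ∫ z in (0 : ℝ)..1, g z := by
  rw [integral_cell_prod hx.le hy.le (fun x => 2 * Real.sin (x / l) ^ 2) g,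
    integral_two_sin_sq hl hx hk]
  field_simp

theorem IsCutoff.continuous_rollVelocity (h : IsCutoff M δ χ) (hx : 0 < lx)
    (hk : 1 / l = 2 * Real.pi / lx * k) : Continuous (rollVelocity χ l) := by
  have hg := continuous_gradient (h.isTestFunction_rollStream (ly := 1) hx hk).smooth
  have h0 : Continuous fun p => gradient (rollStream χ l) p 0 :=
    (contDiff_coord (n := 0) 0).continuous.comp hg
  have h2 : Continuous fun p => gradient (rollStream χ l) p 2 :=
    (contDiff_coord (n := 0) 2).continuous.comp hg
  refine (PiLp.continuous_toLp 2 _).comp (continuous_pi fun i => ?_)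
  fin_cases i
  · exact h2.neg
  · exact continuous_const
  · exact h0

/-- The convection rolls are admissible. -/
theorem IsCutoff.isAdmissible_roll (h : IsCutoff M δ χ) (hl : 0 < l) (hx : 0 < lx) (hy : 0 < ly)
    (hk : 1 / l = 2 * Real.pi / lx * k) :
    IsAdmissible lx ly (rollVelocity χ l) (rollTest χ l) where
  u_memLp := memLp_cell_of_continuous (h.continuous_rollVelocity hx hk) 2
  u_divFree φ hφ := integral_inner_streamfunction_eq_zero hx.le hy.le
    (h.isTestFunction_rollStream hx hk) hφ.toIsSmoothPeriodic
  u_walls φ hφ := integral_inner_streamfunction_eq_zero hx.le hy.le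
    (h.isTestFunction_rollStream hx hk) hφ
  ξ_bounded := memLp_cell_of_continuous
    (h.isTestFunction_rollTest (ly := ly) hx hk).smooth.continuous ⊤
  ξ_mem_H10 := ⟨_, (h.isTestFunction_rollTest hx hk).hasH10Gradient⟩
  flux := by
    rw [setAverage_cell hx.le hy.le, ← h.normalized,
      ← average_two_sin_sq_mul hl hx hy hk fun z => χ z ^ 2]
    congr 1
    refine integral_congr_ae (ae_of_all _ fun p => ?_)
    have h1 : √l * √l = l := Real.mul_self_sqrt hl.le
    have h2 : √2 * √2 = (2 : ℝ) := Real.mul_self_sqrt zero_le_two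
    simp only [h.rollVelocity_eq, rollTest_eq]
    simp only [Matrix.cons_val]
    calc χ (p 2) * -(√l * √2 / l * Real.sin (p 0 / l))
          * (χ (p 2) * (-(√l * √2) * Real.sin (p 0 / l)))
        = (√l * √l) * (√2 * √2) / l * Real.sin (p 0 / l) ^ 2 * χ (p 2) ^ 2 := by ring
      _ = _ := by rw [h1, h2]; field_simp

/-- By `2 sin² = 1 + (sin² - cos²)`, the flux `ξu` splits into `χ² e_z` and the planar field with
streamfunction `P = -l χ² sin cos`. Neither that field nor the constant `e_z` acts on gradients of
test functions, so `ξu` may be replaced by `(χ² - 1) e_z`, which is already a gradient. -/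
theorem IsCutoff.isInvLaplacianDiv_roll (h : IsCutoff M δ χ) (hl : 0 < l) (hx : 0 < lx)
    (hy : 0 < ly) (hk : 1 / l = 2 * Real.pi / lx * k) :
    IsInvLaplacianDiv lx ly (fun p => rollTest χ l p • rollVelocity χ l p)
      (fun p => layerPotential χ (p 2)) (fun p => !₂[0, 0, χ (p 2) ^ 2 - 1]) where
  mem_H10 := h.hasH10Gradient_layerPotential
  weak_eq φ hφ := by
    set P : R3 → ℝ := fun p => χ (p 2) ^ 2 * ((fun x => -l * Real.sin (x / l) * Real.cos (x / l)) (p 0))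
      with hPdef
    have hP : IsTestFunction lx ly P := by
      refine isTestFunction_mul_coord (b := fun z => χ z ^ 2) (h.smooth.pow 2)
        ((contDiff_const.mul (contDiff_id.div_const l).sin).mul (contDiff_id.div_const l).cos)
        (fun x => ?_) ?_
      · simp only [id, sin_div_add_period hx hk, cos_div_add_period hx hk]
      · obtain ⟨r, hr, hz⟩ := h.exists_vanishing
        exact ⟨r, hr, fun z hm => by simp [hz z hm]⟩
    have hPg : ∀ p : R3, gradient P p = !₂[χ (p 2) ^ 2 * (Real.sin (p 0 / l) ^ 2
        - Real.cos (p 0 / l) ^ 2), 0, 2 * χ (p 2) * deriv χ (p 2)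
          * (-l * Real.sin (p 0 / l) * Real.cos (p 0 / l))] := fun p => by
      have hb : HasDerivAt (fun z => χ z ^ 2) (2 * χ (p 2) * deriv χ (p 2)) (p 2) := by
        refine ((h.hasDerivAt (p 2)).pow 2).congr_deriv ?_
        simp
      have ha := (hasDerivAt_sin_div (-l) l (p 0)).mul
        (((hasDerivAt_id (p 0)).div_const l).cos)
      refine (gradient_mul_coord hb ha).trans ?_
      ext i
      fin_cases i
      · simp only [Fin.zero_eta, Matrix.cons_val_zero, id]
        field_simp
        ring
      · rfl
      · rfl
    have hφg := continuous_gradient hφ.smooth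
    have hz : ∫ p in cell lx ly, gradient φ p 2 = 0 := by
      simp only [gradient_apply]
      exact integral_cell_partial_z_eq_zero hx.le hy.le
        (hφ.smooth.of_le (by exact_mod_cast le_top)) fun p hp => hφ.eq_zero_of_wall hp
    have hcurl := integral_inner_streamfunction_eq_zero hx.le hy.le hP hφ.toIsSmoothPeriodic
    have cm : Continuous fun p => rollTest χ l p • rollVelocity χ l p :=
      (h.isTestFunction_rollTest (ly := ly) hx hk).smooth.continuous.smul
        (h.continuous_rollVelocity hx hk)
    have i1 : IntegrableOn (fun p => inner ℝ (rollTest χ l p • rollVelocity χ l p) (gradient φ p))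
        (cell lx ly) := integrableOn_cell_of_continuous (cm.inner hφg)
    have i2 : IntegrableOn (fun p => gradient φ p 2) (cell lx ly) :=
      integrableOn_cell_of_continuous ((contDiff_coord (n := 0) 2).continuous.comp hφg)
    have i3 : IntegrableOn (fun p => inner ℝ
        (!₂[-(gradient P p 2), 0, gradient P p 0] : R3) (gradient φ p)) (cell lx ly) := by
      refine integrableOn_cell_of_continuous (Continuous.inner ?_ hφg)
      have hPc := continuous_gradient hP.smooth
      refine (PiLp.continuous_toLp 2 _).comp (continuous_pi fun i => ?_)
      fin_cases i
      · exact ((contDiff_coord (n := 0) 2).continuous.comp hPc).neg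
      · exact continuous_const
      · exact (contDiff_coord (n := 0) 0).continuous.comp hPc
    have key := integral_sub (i1.sub i2) i3
    have key2 := integral_sub i1 i2
    simp only [Pi.sub_apply] at key
    rw [hcurl, sub_zero, key2, hz, sub_zero] at key
    rw [← key]
    refine integral_congr_ae (ae_of_all _ fun p => ?_)
    have h1 : √l * √l = l := Real.mul_self_sqrt hl.le
    have h2 : √2 * √2 = (2 : ℝ) := Real.mul_self_sqrt zero_le_two
    have e1 : rollTest χ l p * rollVelocity χ l p 0 = 2 * l * (χ (p 2) * deriv χ (p 2)
        * (Real.sin (p 0 / l) * Real.cos (p 0 / l))) := by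
      simp only [h.rollVelocity_eq, rollTest_eq, PiLp.toLp_apply, Matrix.cons_val_zero]
      calc _ = (√l * √l) * (√2 * √2) * (χ (p 2) * deriv χ (p 2)
            * (Real.sin (p 0 / l) * Real.cos (p 0 / l))) := by ring
        _ = _ := by rw [h1, h2]; ring
    have e3 : rollTest χ l p * rollVelocity χ l p 2 = 2 * χ (p 2) ^ 2 * Real.sin (p 0 / l) ^ 2 := by
      simp only [h.rollVelocity_eq, rollTest_eq, PiLp.toLp_apply, Matrix.cons_val]
      calc _ = (√l * √l) * (√2 * √2) / l * χ (p 2) ^ 2 * Real.sin (p 0 / l) ^ 2 := by ring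
        _ = _ := by rw [h1, h2]; field_simp
    have e2 : rollVelocity χ l p 1 = 0 := rfl
    have hcs := Real.sin_sq_add_cos_sq (p 0 / l)
    have hcos : Real.cos (p 0 / l) ^ 2 = 1 - Real.sin (p 0 / l) ^ 2 := by linarith
    beta_reduce
    rw [real_inner_smul_left]
    simp only [inner_eq, mul_add, ← mul_assoc, e1, e3, e2, hPg, PiLp.toLp_apply, Matrix.cons_val]
    rw [hcos]
    ring

theorem IsCutoff.average_norm_sq_rollVelocity (h : IsCutoff M δ χ) (hl : 0 < l) (hx : 0 < lx)
    (hy : 0 < ly) (hk : 1 / l = 2 * Real.pi / lx * k) :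
    ⨍ p in cell lx ly, ‖rollVelocity χ l p‖ ^ 2
      = l * (∫ z in (0 : ℝ)..1, deriv χ z ^ 2) + 1 / l := by
  have h1 : √l ^ 2 = l := Real.sq_sqrt hl.le
  have h2 : √2 ^ 2 = (2 : ℝ) := Real.sq_sqrt zero_le_two
  have c1 : Continuous (deriv χ) := continuous_deriv_of_smooth h.smooth
  have c2 : Continuous χ := h.smooth.continuous
  have hz : Continuous fun p : R3 => p 2 := (contDiff_coord (n := 0) 2).continuous
  have hx0 : Continuous fun p : R3 => p 0 := (contDiff_coord (n := 0) 0).continuous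
  rw [setAverage_cell hx.le hy.le]
  have e : ∀ p : R3, ‖rollVelocity χ l p‖ ^ 2
      = 2 * Real.cos (p 0 / l) ^ 2 * (fun z => l * deriv χ z ^ 2) (p 2)
        + 2 * Real.sin (p 0 / l) ^ 2 * (fun z => 1 / l * χ z ^ 2) (p 2) := fun p => by
    rw [norm_sq_eq, h.rollVelocity_eq]
    simp only [Matrix.cons_val]
    calc _ = √l ^ 2 * √2 ^ 2 * (deriv χ (p 2) ^ 2 * Real.cos (p 0 / l) ^ 2)
          + √l ^ 2 * √2 ^ 2 / l ^ 2 * (χ (p 2) ^ 2 * Real.sin (p 0 / l) ^ 2) := by ring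
      _ = _ := by rw [h1, h2]; field_simp
  simp only [e]
  rw [integral_add, mul_add, average_two_cos_sq_mul hl hx hy hk fun z => l * deriv χ z ^ 2,
    average_two_sin_sq_mul hl hx hy hk fun z => 1 / l * χ z ^ 2,
    intervalIntegral.integral_const_mul, intervalIntegral.integral_const_mul, h.normalized, mul_one]
  · exact integrableOn_cell_of_continuous (by fun_prop)
  · exact integrableOn_cell_of_continuous (by fun_prop)

theorem IsCutoff.average_norm_sq_gradient_rollTest (h : IsCutoff M δ χ) (hl : 0 < l) (hx : 0 < lx)
    (hy : 0 < ly) (hk : 1 / l = 2 * Real.pi / lx * k) :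
    ⨍ p in cell lx ly, ‖gradient (rollTest χ l) p‖ ^ 2
      = l * (∫ z in (0 : ℝ)..1, deriv χ z ^ 2) + 1 / l := by
  have h1 : √l ^ 2 = l := Real.sq_sqrt hl.le
  have h2 : √2 ^ 2 = (2 : ℝ) := Real.sq_sqrt zero_le_two
  have c1 : Continuous (deriv χ) := continuous_deriv_of_smooth h.smooth
  have c2 : Continuous χ := h.smooth.continuous
  have hz : Continuous fun p : R3 => p 2 := (contDiff_coord (n := 0) 2).continuous
  have hx0 : Continuous fun p : R3 => p 0 := (contDiff_coord (n := 0) 0).continuous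
  rw [setAverage_cell hx.le hy.le]
  have e : ∀ p : R3, ‖gradient (rollTest χ l) p‖ ^ 2
      = 2 * Real.sin (p 0 / l) ^ 2 * (fun z => l * deriv χ z ^ 2) (p 2)
        + 2 * Real.cos (p 0 / l) ^ 2 * (fun z => 1 / l * χ z ^ 2) (p 2) := fun p => by
    rw [norm_sq_eq, h.gradient_rollTest]
    simp only [Matrix.cons_val]
    calc _ = √l ^ 2 * √2 ^ 2 * (deriv χ (p 2) ^ 2 * Real.sin (p 0 / l) ^ 2)
          + √l ^ 2 * √2 ^ 2 / l ^ 2 * (χ (p 2) ^ 2 * Real.cos (p 0 / l) ^ 2) := by ring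
      _ = _ := by rw [h1, h2]; field_simp
  simp only [e]
  rw [integral_add, mul_add, average_two_sin_sq_mul hl hx hy hk fun z => l * deriv χ z ^ 2,
    average_two_cos_sq_mul hl hx hy hk fun z => 1 / l * χ z ^ 2,
    intervalIntegral.integral_const_mul, intervalIntegral.integral_const_mul, h.normalized, mul_one]
  · exact integrableOn_cell_of_continuous (by fun_prop)
  · exact integrableOn_cell_of_continuous (by fun_prop)

theorem average_norm_sq_coord (hx : 0 < lx) (hy : 0 < ly) (f : ℝ → ℝ) :
    ⨍ p in cell lx ly, ‖(!₂[0, 0, f (p 2)] : R3)‖ ^ 2 = ∫ z in (0 : ℝ)..1, f z ^ 2 := by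
  rw [setAverage_cell hx.le hy.le]
  have e : ∀ p : R3, ‖(!₂[0, 0, f (p 2)] : R3)‖ ^ 2 = 1 * (fun z => f z ^ 2) (p 2) := fun p => by
    rw [norm_sq_eq]; simp
  simp only [e]
  rw [integral_cell_prod hx.le hy.le (fun _ => 1) fun z => f z ^ 2]
  simp
  field_simp

/-- The energy of the convection rolls. -/
theorem IsCutoff.hasEnergy_roll (h : IsCutoff M δ χ) (hl : 0 < l) (hx : 0 < lx) (hy : 0 < ly)
    (hk : 1 / l = 2 * Real.pi / lx * k) (ε : ℝ) :
    HasEnergy lx ly ε (rollVelocity χ l) (rollTest χ l)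
      ((∫ z in (0 : ℝ)..1, (χ z ^ 2 - 1) ^ 2)
        + ε * (l * (∫ z in (0 : ℝ)..1, deriv χ z ^ 2) + 1 / l) ^ 2) := by
  refine ⟨_, _, _, (h.isTestFunction_rollTest hx hk).hasH10Gradient,
    h.isInvLaplacianDiv_roll hl hx hy hk, ?_⟩
  rw [h.average_norm_sq_rollVelocity hl hx hy hk, h.average_norm_sq_gradient_rollTest hl hx hy hk,
    average_norm_sq_coord hx hy fun z => χ z ^ 2 - 1]
  ring

/-- A continuous function supported in two boundary layers. -/
theorem integral_le_of_layers {f : ℝ → ℝ} (hf : Continuous f) {B : ℝ} (hδ : 0 < δ)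
    (hδ2 : δ < 1 / 2) (hB : ∀ z, f z ≤ B) (h0 : ∀ z ∈ Ioo δ (1 - δ), f z = 0) :
    ∫ z in (0 : ℝ)..1, f z ≤ 2 * δ * B := by
  have hb : ∀ a b : ℝ, a ≤ b → ∫ z in a..b, f z ≤ (b - a) * B := fun a b hab => by
    have := intervalIntegral.integral_mono_on hab (hf.intervalIntegrable (μ := volume) a b)
      (continuous_const.intervalIntegrable a b) (g := fun _ => B) fun z _ => hB z
    simpa using this
  -- Only the open bulk interval is needed, so nothing is asked of `f` at the edges of the layers.
  have hm : ∫ z in δ..(1 - δ), f z = 0 := by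
    rw [intervalIntegral.integral_of_le (by linarith), integral_Ioc_eq_integral_Ioo]
    exact setIntegral_eq_zero_of_forall_eq_zero h0
  rw [← intervalIntegral.integral_add_adjacent_intervals (hf.intervalIntegrable 0 δ)
      (hf.intervalIntegrable δ 1),
    ← intervalIntegral.integral_add_adjacent_intervals (hf.intervalIntegrable δ (1 - δ))
      (hf.intervalIntegrable _ 1), hm]
  have h1 := hb 0 δ hδ.le
  have h2 := hb (1 - δ) 1 (by linarith)
  linarith

theorem IsCutoff.integral_sq_sub_one_sq_le (h : IsCutoff M δ χ) (hδ : 0 < δ) (hδ2 : δ < 1 / 2) :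
    ∫ z in (0 : ℝ)..1, (χ z ^ 2 - 1) ^ 2 ≤ 2 * δ * (M ^ 2 + 1) ^ 2 := by
  refine integral_le_of_layers (((h.smooth.continuous.pow 2).sub continuous_const).pow 2) hδ hδ2
    (fun z => ?_) fun z hz => ?_
  · have h1 : χ z ^ 2 ≤ M ^ 2 := sq_le_sq' (abs_le.1 (h.bound z)).1 (abs_le.1 (h.bound z)).2
    change (χ z ^ 2 - 1) ^ 2 ≤ _
    nlinarith [sq_nonneg (χ z), sq_nonneg M]
  · simp [h.eq_one z (Ioo_subset_Icc_self hz)]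

theorem IsCutoff.integral_deriv_sq_le (h : IsCutoff M δ χ) (hδ : 0 < δ) (hδ2 : δ < 1 / 2) :
    ∫ z in (0 : ℝ)..1, deriv χ z ^ 2 ≤ 2 * M ^ 2 / δ := by
  have h1 := integral_le_of_layers ((continuous_deriv_of_smooth h.smooth).pow 2) (B := (M / δ) ^ 2)
    hδ hδ2 (fun z => sq_le_sq' (abs_le.1 (h.deriv_bound z)).1 (abs_le.1 (h.deriv_bound z)).2)
    fun z hz => by
      have : χ =ᶠ[𝓝 z] fun _ => 1 := by
        filter_upwards [Ioo_mem_nhds hz.1 hz.2] with w hw using h.eq_one w (Ioo_subset_Icc_self hw)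
      rw [Pi.pow_apply, this.deriv_eq]; simp
  refine h1.trans (le_of_eq ?_)
  field_simp

end Roll

/-! ### Choice of scales. -/

/-- There are roll widths commensurable with the period in each interval `[r / C, r]`. -/
theorem exists_roll_width {r κ : ℝ} (hx : 0 < lx) (hr : 0 < r) (hrx : r ≤ κ * lx) :
    ∃ (l : ℝ) (k : ℕ), 0 < k ∧ 0 < l ∧ 1 / l = 2 * Real.pi / lx * k ∧ l ≤ r ∧
      1 / l ≤ (1 + 2 * Real.pi * κ) / r := by
  have hpi := Real.pi_pos
  -- The least number of periods for which `l = lx / (2πk)` does not exceed `r`. Rounding up adds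
  -- less than one to `k`, hence less than `2π/lx ≤ 2πκ/r` to `1/l`.
  set k := ⌈lx / (2 * Real.pi * r)⌉₊ with hk
  have hk0 : 0 < k := Nat.ceil_pos.2 (by positivity)
  have hk0' : (0 : ℝ) < k := Nat.cast_pos.2 hk0
  have hle : lx / (2 * Real.pi * r) ≤ k := Nat.le_ceil _
  have hlt : (k : ℝ) < lx / (2 * Real.pi * r) + 1 := Nat.ceil_lt_add_one (by positivity)
  have h1 : 1 / (lx / (2 * Real.pi * k)) = 2 * Real.pi / lx * k := by field_simp
  refine ⟨lx / (2 * Real.pi * k), k, hk0, by positivity, h1, ?_, ?_⟩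
  · rw [div_le_iff₀ (by positivity)] at hle ⊢
    linarith
  · rw [h1]
    have h2 : 2 * Real.pi / lx * k ≤ 2 * Real.pi / lx * (lx / (2 * Real.pi * r) + 1) := by gcongr
    refine h2.trans ?_
    have h3 : 2 * Real.pi / lx * (lx / (2 * Real.pi * r) + 1) = (1 + 2 * Real.pi * (r / lx)) / r := by
      field_simp
    rw [h3]
    have h4 : r / lx ≤ κ := by rwa [div_le_iff₀ hx]
    gcongr

/-- The energy of rolls with `δ = δ₀ r²` and width comparable to `r`. -/
theorem roll_energy_le {M δ₀ r l B I J : ℝ} (hδ₀ : 0 < δ₀) (hr : 0 < r) (hl : 0 < l) (hlr : l ≤ r)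
    (hB : 1 / l ≤ B / r) (hI : I ≤ 2 * (δ₀ * r ^ 2) * (M ^ 2 + 1) ^ 2) (hJ0 : 0 ≤ J)
    (hJ : J ≤ 2 * M ^ 2 / (δ₀ * r ^ 2)) :
    I + r ^ 4 * (l * J + 1 / l) ^ 2
      ≤ (2 * δ₀ * (M ^ 2 + 1) ^ 2 + (2 * M ^ 2 / δ₀ + B) ^ 2) * r ^ 2 := by
  have h1 : l * J + 1 / l ≤ (2 * M ^ 2 / δ₀ + B) / r := by
    have h2 : l * J ≤ r * (2 * M ^ 2 / (δ₀ * r ^ 2)) := by gcongr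
    have h3 : r * (2 * M ^ 2 / (δ₀ * r ^ 2)) = 2 * M ^ 2 / δ₀ / r := by field_simp
    rw [add_div]
    linarith
  have h4 : r ^ 4 * (l * J + 1 / l) ^ 2 ≤ r ^ 4 * ((2 * M ^ 2 / δ₀ + B) / r) ^ 2 := by gcongr
  have h5 : r ^ 4 * ((2 * M ^ 2 / δ₀ + B) / r) ^ 2 = (2 * M ^ 2 / δ₀ + B) ^ 2 * r ^ 2 := by
    field_simp
  linarith

/-- The rolls of optimal scaling, with constants depending only on `K`. -/
theorem exists_optimal_rolls {N K : ℝ} {η : ℝ → ℝ} (hN : 1 ≤ N) (hη : IsLayerProfile N η)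
    (hK : 0 < K) :
    ∃ c C : ℝ, 0 < c ∧ 0 < C ∧ ∀ lx ly ε : ℝ, 0 < lx → 0 < ly → 0 < ε → ε ≤ K → ε ≤ K * lx ^ 4 →
      ∃ (δ l : ℝ) (k : ℕ) (χ : ℝ → ℝ),
        0 < δ ∧ δ < 1 / 2 ∧ c * √ε ≤ δ ∧ δ ≤ C * √ε ∧
        0 < k ∧ 0 < l ∧ 1 / l = 2 * Real.pi / lx * k ∧ c * √δ ≤ l ∧ l ≤ C * √δ ∧
        IsCutoff (2 * N ^ 2) δ χ ∧ IsAdmissible lx ly (rollVelocity χ l) (rollTest χ l) ∧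
        ∃ E : ℝ, HasEnergy lx ly ε (rollVelocity χ l) (rollTest χ l) E ∧ E ≤ C * √ε := by
  have hpi := Real.pi_pos
  -- The layer thickness will be `δ₀ √ε`; since `√ε ≤ √K`, this choice keeps it below `1/2`.
  set δ₀ : ℝ := 1 / (4 * (1 + √K)) with hδ₀
  set κ : ℝ := √√K with hκ
  set B : ℝ := 1 + 2 * Real.pi * κ with hB
  set s₀ : ℝ := √δ₀ with hs₀
  have hK0 : 0 < √K := Real.sqrt_pos.2 hK
  have hκ0 : 0 < κ := Real.sqrt_pos.2 hK0
  have hδ₀0 : 0 < δ₀ := by positivity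
  have hs₀0 : 0 < s₀ := Real.sqrt_pos.2 hδ₀0
  have hB0 : 0 < B := by positivity
  set D : ℝ := 2 * δ₀ * ((2 * N ^ 2) ^ 2 + 1) ^ 2 + (2 * (2 * N ^ 2) ^ 2 / δ₀ + B) ^ 2
  have hD0 : 0 < D := by positivity
  refine ⟨min δ₀ (1 / (B * s₀)), δ₀ + 1 / s₀ + D, by positivity, by positivity, ?_⟩
  intro lx ly ε hx hy hε hεK hεx
  -- The target roll width `ε^{1/4}`. With `κ = K^{1/4}`, the hypothesis `ε ≤ K lx⁴` becomes `r ≤ κ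
  -- lx`.
  set r : ℝ := √√ε with hr
  have hsε : 0 < √ε := Real.sqrt_pos.2 hε
  have hr0 : 0 < r := Real.sqrt_pos.2 hsε
  have hr2 : √ε = r ^ 2 := (Real.sq_sqrt hsε.le).symm
  have hr4 : ε = r ^ 4 := by
    rw [← Real.sq_sqrt hε.le, hr2]; ring
  have hrx : r ≤ κ * lx := by
    have h1 : κ ^ 4 = K := by
      have : κ ^ 4 = (κ ^ 2) ^ 2 := by ring
      rw [this, hκ, Real.sq_sqrt hK0.le, Real.sq_sqrt hK.le]
    refine (pow_le_pow_iff_left₀ hr0.le (by positivity) (four_ne_zero)).1 ?_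
    rw [mul_pow, h1, ← hr4]
    exact hεx
  have hrK : r ^ 2 ≤ √K := by rw [← hr2]; exact Real.sqrt_le_sqrt hεK
  obtain ⟨l, k, hk0, hl, hk, hlr, hlB⟩ := exists_roll_width hx hr0 hrx
  have hδ : 0 < δ₀ * r ^ 2 := by positivity
  have hδ2 : δ₀ * r ^ 2 < 1 / 2 := by
    rw [hδ₀, div_mul_eq_mul_div, one_mul, div_lt_div_iff₀ (by positivity) two_pos]
    linarith
  have hsδ : √(δ₀ * r ^ 2) = s₀ * r := by
    rw [Real.sqrt_mul hδ₀0.le, Real.sqrt_sq hr0.le]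
  have hχ := hη.isCutoff hN hδ hδ2
  rw [hr2]
  have hrl : r ≤ B * l := by
    rw [div_le_div_iff₀ hl hr0] at hlB
    linarith
  refine ⟨δ₀ * r ^ 2, l, k, layerCutoff η (δ₀ * r ^ 2), hδ, hδ2, ?_, ?_, hk0, hl, hk, ?_, ?_, hχ,
    hχ.isAdmissible_roll hl hx hy hk, _, hχ.hasEnergy_roll hl hx hy hk ε, ?_⟩
  · exact mul_le_mul_of_nonneg_right (min_le_left _ _) (by positivity)
  · exact mul_le_mul_of_nonneg_right (by linarith [one_div_pos.2 hs₀0]) (by positivity)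
  · rw [hsδ]
    calc min δ₀ (1 / (B * s₀)) * (s₀ * r) ≤ 1 / (B * s₀) * (s₀ * r) := by
          gcongr; exact min_le_right _ _
      _ = r / B := by field_simp
      _ ≤ l := by rw [div_le_iff₀ hB0]; linarith
  · rw [hsδ]
    calc l ≤ 1 / s₀ * (s₀ * r) := by field_simp; exact hlr
      _ ≤ _ := mul_le_mul_of_nonneg_right (by linarith) (by positivity)
  · have hJ0 : 0 ≤ ∫ z in (0 : ℝ)..1, deriv (layerCutoff η (δ₀ * r ^ 2)) z ^ 2 :=
      intervalIntegral.integral_nonneg zero_le_one fun z _ => sq_nonneg _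
    have key := roll_energy_le hδ₀0 hr0 hl hlr hlB (hχ.integral_sq_sub_one_sq_le hδ hδ2) hJ0
      (hχ.integral_deriv_sq_le hδ hδ2)
    rw [hr4]
    refine key.trans (mul_le_mul_of_nonneg_right ?_ (by positivity))
    linarith [one_div_pos.2 hs₀0]

end WallToWall

/-! ### Assembly of the two bounds. -/

theorem mainTheorem8 :
    ∃ M : ℝ, 0 < M ∧ ∀ K : ℝ, 0 < K → ∃ c C : ℝ, 0 < c ∧ 0 < C ∧
      ∀ lx ly ε : ℝ, 0 < lx → 0 < ly → 0 < ε → ε ≤ K * min 1 (min (lx ^ 4) (ly ^ 4)) →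
        (c * √ε ≤ WallToWall.optimalValue lx ly ε ∧
          WallToWall.optimalValue lx ly ε ≤ C * √ε) ∧
        ∃ (δ l : ℝ) (k : ℕ) (χ : ℝ → ℝ),
          0 < δ ∧ δ < 1 / 2 ∧ c * √ε ≤ δ ∧ δ ≤ C * √ε ∧
          0 < k ∧ 0 < l ∧ 1 / l = 2 * Real.pi / lx * k ∧ c * √δ ≤ l ∧ l ≤ C * √δ ∧
          WallToWall.IsCutoff M δ χ ∧
          WallToWall.IsAdmissible lx ly
            (WallToWall.rollVelocity χ l) (WallToWall.rollTest χ l) ∧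
          ∃ E : ℝ, WallToWall.HasEnergy lx ly ε
            (WallToWall.rollVelocity χ l) (WallToWall.rollTest χ l) E ∧ E ≤ C * √ε := by

  obtain ⟨N, η, hN, hη⟩ := WallToWall.exists_isLayerProfile
  refine ⟨2 * N ^ 2, by positivity, fun K hK => ?_⟩
  obtain ⟨c, C, hc, hC, hroll⟩ := WallToWall.exists_optimal_rolls hN hη hK
  refine ⟨min c (1 / (16 * (1 + √K))), C, by positivity, hC, ?_⟩
  intro lx ly ε hx hy hε hle
  have hεK : ε ≤ K := hle.trans (mul_le_of_le_one_right hK.le (min_le_left _ _))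
  have hεx : ε ≤ K * lx ^ 4 := hle.trans
    (mul_le_mul_of_nonneg_left ((min_le_right _ _).trans (min_le_left _ _)) hK.le)
  obtain ⟨δ, l, k, χ, hδ, hδ2, h1, h2, hk, hl, hlk, h3, h4, hχ, hadm, E, hE, hEle⟩ :=
    hroll lx ly ε hx hy hε hεK hεx
  have hlow : ∀ E ∈ {E | ∃ u ξ, WallToWall.IsAdmissible lx ly u ξ ∧
      WallToWall.HasEnergy lx ly ε u ξ E}, 1 / (16 * (1 + √K)) * √ε ≤ E := by
    rintro E ⟨u, ξ, ha, hE⟩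
    exact WallToWall.energy_lower_bound hK hx hy hε hεK ha hE
  refine ⟨⟨?_, ?_⟩, δ, l, k, χ, hδ, hδ2, ?_, h2, hk, hl, hlk, ?_, h4, hχ, hadm, E, hE, hEle⟩
  · refine (mul_le_mul_of_nonneg_right (min_le_right _ _) (Real.sqrt_nonneg _)).trans ?_
    -- The rolls show that the set of energies is nonempty, and `hlow` that it is bounded below, so
    -- the real `sInf` is a genuine infimum and not its default value.
    exact le_csInf ⟨E, _, _, hadm, hE⟩ hlow
  · exact (csInf_le ⟨_, hlow⟩ ⟨_, _, hadm, hE⟩).trans hEle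
  · exact (mul_le_mul_of_nonneg_right (min_le_left _ _) (Real.sqrt_nonneg _)).trans h1
  · exact (mul_le_mul_of_nonneg_right (min_le_left _ _) (Real.sqrt_nonneg _)).trans h3
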